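/- Consider one of the following random models, in which $[N]=\{1,\dots,N\}$ is the set of nodes (variables) and $M$ hyperedges (clauses) are drawn independently and uniformly, with replacement, from $[N]^K$ (so the nodes of a hyperedge are ordered and may repeat). The value of an assignment $x\in\{0,\dots,q-1\}^N$ is $H(x)=\sum_e H_e(x_e)$, where $x_e$ is the tuple of the values of $x$ at the nodes of the hyperedge $e$, and: - Coloring with $q\ge 1$ colors: $K=2$, and $H_e(y_1,y_2)=0$ if $y_1=y_2$ and $1$ otherwise; - K-SAT ($K\ge 2$, $q=2$): each hyperedge $e$ carries an independent uniform $a_e\in\{0,1\}^K$, and $H_e(y)=0$ if $y=a_e$ and $1$ otherwise; - NAE-K-SAT ($K\ge 2$, $q=2$): as for K-SAT, but $H_e(y)=0$ if $y=a_e$ or $y=(1,\dots,1)-a_e$, and $1$ otherwise. Let $\mathbb G(N,M)$ denote the resulting random instance, let $H(\mathbb G(N,M))=\max_x H(x)$, and let $p(N,M)=\mathbb P\big(H(\mathbb G(N,M))=M\big)$ be the probability of satisfiability. Then for each of these models: 1. For every $c>0$ there is a real number $H(c)$ such that $N^{-1}H(\mathbb G(N,\lfloor cN\rfloor))\to H(c)$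 in probability as $N\to\infty$. Moreover there is a critical value $c^*_H\in[0,\infty)$ such that, for $c>0$, $H(c)=c$ when $c<c^*_H$ and $H(c)<c$ when $c>c^*_H$. 2. If $q\ge 2$ (which excludes only Coloring with one color), then for every $c>0$ one has $p(N,\lfloor cN\rfloor)>0$ for all sufficiently large $N$, and the limit $p(c)=\lim_{N\to\infty}N^{-1}\log p(N,\lfloor cN\rfloor)\in\mathbb R$ exists. Moreover there is a critical value $c^*_p\in[0,\infty)$ such that, for $c>0$, $p(c)=0$ when $c<c^*_p$ and $p(c)<0$ when $c>c^*_p$. -/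

import Mathlib

open Filter Topology

/-- A random constraint model with zero node potentials: the hyperedges have `K` ordered nodes,
the alphabet is `{0, …, q - 1}`, every hyperedge receives an independent uniform label from the
finite set `Label`, and `edgePot a y` is the edge potential with label `a` at the values `y` of the
`K` nodes of the hyperedge. -/
structure ConstraintModel where
  K : ℕ
  q : ℕ
  Label : Type
  [fintypeLabel : Fintype Label]
  [nonemptyLabel : Nonempty Label]
  edgePot : Label → (Fin K → Fin q) → ℝ

attribute [instance] ConstraintModel.fintypeLabel ConstraintModel.nonemptyLabel

/-- `q`-Coloring: an edge has value `0` if its two ends have the same color and `1` otherwise.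
The edge potential is deterministic. -/
def coloringModel (q : ℕ) : ConstraintModel where
  K := 2
  q := q
  Label := Unit
  edgePot _ y := if y 0 = y 1 then 0 else 1

/-- Random K-SAT: a clause has value `0` exactly at its uniformly random label in `{0,1}^K`. -/
def kSATModel (K : ℕ) : ConstraintModel where
  K := K
  q := 2
  Label := Fin K → Fin 2
  edgePot a y := if y = a then 0 else 1

/-- Random NAE-K-SAT: a clause has value `0` exactly at its uniformly random label `a` and at
the complement `1 - a`. -/
def naeKSATModel (K : ℕ) : ConstraintModel where
  K := K
  q := 2
  Label := Fin K → Fin 2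
  edgePot a y := if y = a ∨ y = (fun i => 1 - a i) then 0 else 1

namespace ConstraintModel

/-- The labelled directed hypergraphs with nodes `Fin N` and `M` hyperedges: each of the `M`
hyperedges is a tuple in `[N]^K` (repetitions allowed) with a label. -/
def Instance (m : ConstraintModel) (N M : ℕ) : Type :=
  Fin M → (Fin m.K → Fin N) × m.Label

instance (m : ConstraintModel) (N M : ℕ) : MeasurableSpace (m.Instance N M) := ⊤

/-- The law of the random hypergraph `G(N, M)` with its random potentials: the `M` hyperedges are
drawn uniformly with replacement from `[N]^K`, and their labels independently and uniformly. -/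
noncomputable def law (m : ConstraintModel) (N M : ℕ) : MeasureTheory.Measure (m.Instance N M) :=
  ProbabilityTheory.uniformOn Set.univ

/-- The value `H(x)` of an assignment `x`. -/
noncomputable def value (m : ConstraintModel) {N M : ℕ} (G : m.Instance N M)
    (x : Fin N → Fin m.q) : ℝ :=
  ∑ j : Fin M, m.edgePot (G j).2 (fun k => x ((G j).1 k))

/-- The optimal value `H(G)`. -/
noncomputable def optValue (m : ConstraintModel) {N M : ℕ} (G : m.Instance N M) : ℝ :=
  ⨆ x : Fin N → Fin m.q, m.value G x

/-- The probability of satisfiability `p(N, M)`. -/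
noncomputable def satProb (m : ConstraintModel) (N M : ℕ) : ℝ :=
  (m.law N M).real {G | m.optValue G = (M : ℝ)}

end ConstraintModel

/-!
The proof is the interpolation method for sparse random hypergraphs. Let `μ(G)` be the least
number of hyperedges of `G` that an assignment violates, so that the optimal value is `M - μ(G)`
and satisfiability means `μ(G) = 0`.

*Interpolation.* Adding a hyperedge `e` to `G` raises `μ` by one exactly when every optimal
assignment of `G` violates `e`. In each model the proportion of such hyperedges is a positive
combination of powers `(|S ∩ F| / |S|) ^ K`, where `S` is the node set and `F` runs over the
frozen set (K-SAT) or over classes of nodes whose values determine each other (Coloring,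
NAE-K-SAT); this is `ConstraintModel.IsConvex.frozen`. By convexity of `t ↦ t ^ K`, a hyperedge
on all `N₁ + N₂` nodes raises `μ` less often than one placed inside one of the two parts, chosen
with probabilities `Nᵢ / (N₁ + N₂)` (`IsConvex.avgCons_step`). The operators `avgCons` that
average over an added hyperedge are positive and commute, so the hyperedges can be exchanged one
at a time and the binomial theorem applies: with `k` binomial, the mean of `μ` is at most the
average over `k` of the sum of the means for `(N₁, k)` and `(N₂, M - k)`, and the probability of
satisfiability is at least the average of the product of the two probabilities.

*Limits.* Replacing `k` by its typical value costs an error of order `√(N₁ N₂ / (N₁ + N₂))`: for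
the mean by the binomial variance, for `- log` of the probability by Stirling's formula. Such an
error is absorbed by adding a multiple of `√N`, and Fekete's lemma gives the limits
(`ApproxSubadditive.exists_tendsto`). Both functions are nonnegative and nondecreasing in the
number of hyperedges, and the first moment method bounds them below by `B M - A N` with `B > 0`,
so the zeros of the limit form a bounded interval that starts at `0`.

*Concentration.* One hyperedge changes `μ` by at most one, so its variance is at most `M`, and
Chebyshev's inequality turns the limit of the means into a limit in probability.
-/

/-! ### Averaging over an added element -/

/-- The averaging operator of a map `f : D → E`: it sends a function `Φ` of multisets to the
function `G ↦ 𝔼 Φ (f d ::ₘ G)`, with `d` uniform in `D`. Hence `(avgCons id ^ M) Φ 0` is the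
expectation of `Φ` at a multiset of `M` independent uniform elements. -/
noncomputable def avgCons {D E : Type*} [Fintype D] (f : D → E) :
    Module.End ℝ (Multiset E → ℝ) where
  toFun Φ G := (∑ d, Φ (f d ::ₘ G)) / Fintype.card D
  map_add' Φ Ψ := by
    funext G
    simp [Finset.sum_add_distrib, add_div]
  map_smul' c Φ := by
    funext G
    simp [← Finset.mul_sum, mul_div_assoc]

section avgCons

variable {D D' E E' : Type*} [Fintype D]

lemma avgCons_apply (f : D → E) (Φ : Multiset E → ℝ) (G : Multiset E) :
    avgCons f Φ G = (∑ d, Φ (f d ::ₘ G)) / Fintype.card D := rfl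

lemma avgCons_commute [Fintype D'] (f : D → E) (g : D' → E) : Commute (avgCons f) (avgCons g) := by
  refine LinearMap.ext fun Φ => funext fun G => ?_
  simp only [Module.End.mul_apply, avgCons_apply, ← Finset.sum_div]
  rw [Finset.sum_comm, div_right_comm]
  simp only [Multiset.cons_swap]

lemma avgCons_monotone (f : D → E) : Monotone (avgCons f) := by
  intro Φ Ψ h G
  simp only [avgCons_apply]
  gcongr with d
  exact h _

lemma avgCons_const [Nonempty D] (f : D → E) (c : ℝ) : avgCons f (fun _ => c) = fun _ => c := by
  funext G
  rw [avgCons_apply, Finset.sum_const, Finset.card_univ, nsmul_eq_mul,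
    mul_div_cancel_left₀ _ (by exact_mod_cast Fintype.card_ne_zero)]

lemma monotone_end_pow {T : Module.End ℝ (Multiset E → ℝ)} (hT : Monotone T) (n : ℕ) :
    Monotone (T ^ n) := by
  rw [Module.End.coe_pow]
  exact hT.iterate n

lemma avgCons_pow_const [Nonempty D] (f : D → E) (c : ℝ) (n : ℕ) :
    (avgCons f ^ n) (fun _ => c) = fun _ => c := by
  rw [Module.End.pow_apply]
  exact Function.iterate_fixed (avgCons_const f c) n

/-- Two commuting positive operators that compare on `Φ` compare after iteration: the factors
are exchanged one at a time. -/
lemma pow_apply_le_pow_apply {S T : Module.End ℝ (Multiset E → ℝ)} (hS : Monotone S)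
    (hT : Monotone T) (hST : Commute S T) {Φ : Multiset E → ℝ} (h : S Φ ≤ T Φ) (n : ℕ) :
    (S ^ n) Φ ≤ (T ^ n) Φ := by
  induction n with
  | zero => simp
  | succ n ih =>
    calc (S ^ (n + 1)) Φ = S ((S ^ n) Φ) := by rw [pow_succ', Module.End.mul_apply]
      _ ≤ S ((T ^ n) Φ) := hS ih
      _ = (T ^ n) (S Φ) := by
        rw [← Module.End.mul_apply, (hST.pow_right n).eq, Module.End.mul_apply]
      _ ≤ (T ^ n) (T Φ) := monotone_end_pow hT n h
      _ = (T ^ (n + 1)) Φ := by rw [pow_succ, Module.End.mul_apply]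

lemma avgCons_pow_equiv [Fintype E] (g : E ≃ E') (Φ : Multiset E' → ℝ) [Fintype E'] (n : ℕ) :
    ∀ G : Multiset E, (avgCons (id : E' → E') ^ n) Φ (G.map g) =
      (avgCons (id : E → E) ^ n) (fun H => Φ (H.map g)) G := by
  induction n with
  | zero => simp
  | succ n ih =>
    intro G
    simp only [pow_succ', Module.End.mul_apply, avgCons_apply, id, ← ih, Multiset.map_cons]
    rw [Fintype.card_congr g]
    congr 1
    exact (Equiv.sum_comp g fun e => (avgCons (id : E' → E') ^ n) Φ (e ::ₘ G.map g)).symm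

/-- A function of multisets that changes by at most one when an element is added has variance at
most `n` at `n` independent uniform elements. -/
lemma avgCons_pow_sq_le [Nonempty D] (f : D → E) (n : ℕ) :
    ∀ Φ : Multiset E → ℝ, (∀ e G, |Φ (e ::ₘ G) - Φ G| ≤ 1) →
      ∀ G, (avgCons f ^ n) (fun G => Φ G ^ 2) G ≤ (avgCons f ^ n) Φ G ^ 2 + n := by
  induction n with
  | zero => simp
  | succ n ih =>
    intro Φ hΦ G
    have hD : (0 : ℝ) < Fintype.card D := by exact_mod_cast Fintype.card_pos
    have hstep : avgCons f (fun G => Φ G ^ 2) ≤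
        (fun G => avgCons f Φ G ^ 2) + fun _ => (1 : ℝ) := by
      intro G
      -- The variance is at most the second moment around `Φ G`.
      have h1 : ∑ d, (Φ (f d ::ₘ G) - Φ G) ^ 2 ≤ Fintype.card D := by
        calc ∑ d, (Φ (f d ::ₘ G) - Φ G) ^ 2 ≤ ∑ _d : D, (1 : ℝ) :=
              Finset.sum_le_sum fun d _ => (sq_le_one_iff_abs_le_one _).2 (hΦ _ _)
          _ = Fintype.card D := by simp
      have h2 : ∑ d, (Φ (f d ::ₘ G) - Φ G) ^ 2 = ∑ d, Φ (f d ::ₘ G) ^ 2 -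
          2 * Φ G * ∑ d, Φ (f d ::ₘ G) + Fintype.card D * Φ G ^ 2 := by
        simp only [sub_sq, Finset.sum_add_distrib, Finset.sum_sub_distrib, Finset.mul_sum,
          Finset.sum_const, Finset.card_univ, nsmul_eq_mul]
        congr 2
        exact Finset.sum_congr rfl fun d _ => by ring
      simp only [avgCons_apply, Pi.add_apply]
      rw [div_le_iff₀ hD]
      set s := ∑ d, Φ (f d ::ₘ G) with hs
      have h3 : (s / Fintype.card D) * Fintype.card D = s := div_mul_cancel₀ _ hD.ne'
      set t := s / Fintype.card D
      rw [h2] at h1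
      have h4 := mul_nonneg hD.le (sq_nonneg (t - Φ G))
      rw [← h3] at h1
      linear_combination h1 + h4
    have hlip : ∀ e G, |avgCons f Φ (e ::ₘ G) - avgCons f Φ G| ≤ 1 := by
      intro e G
      simp only [avgCons_apply]
      rw [← sub_div, ← Finset.sum_sub_distrib, abs_div, abs_of_pos hD, div_le_one hD]
      refine (Finset.abs_sum_le_sum_abs _ _).trans ?_
      calc ∑ d, |Φ (f d ::ₘ e ::ₘ G) - Φ (f d ::ₘ G)| ≤ ∑ _d : D, (1 : ℝ) :=
            Finset.sum_le_sum fun d _ => by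
              rw [Multiset.cons_swap]
              exact hΦ _ _
        _ = Fintype.card D := by simp
    have h4 := monotone_end_pow (avgCons_monotone f) n hstep G
    have h5 := ih (avgCons f Φ) hlip G
    rw [pow_succ, Module.End.mul_apply, Module.End.mul_apply]
    rw [map_add, avgCons_pow_const, Pi.add_apply] at h4
    push_cast
    linarith

/-- The expectation at `M` independent uniform elements as an iterate of the averaging
operator. -/
lemma sum_div_card_pow_eq_avgCons_pow [Fintype E] (Φ : Multiset E → ℝ) (M : ℕ) :
    ∀ s : Multiset E, (∑ G : Fin M → E, Φ (Finset.univ.val.map G + s)) / (Fintype.card E : ℝ) ^ M =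
      (avgCons (id : E → E) ^ M) Φ s := by
  induction M with
  | zero => simp
  | succ M ih =>
    intro s
    rw [pow_succ' (avgCons id), Module.End.mul_apply, avgCons_apply]
    simp only [← ih]
    rw [← Finset.sum_div, div_div, ← pow_succ, ← (Fin.consEquiv fun _ => E).sum_comp,
      Fintype.sum_prod_type]
    congr 1
    refine Finset.sum_congr rfl fun e _ => Finset.sum_congr rfl fun G _ => ?_
    congr 1
    rw [Fin.univ_succ, Finset.cons_val, Finset.map_val, Multiset.map_cons, Multiset.map_map,
      Multiset.cons_add, Multiset.add_cons]
    rfl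

lemma avgCons_pow_add_map {F : Type*} [Nonempty D] (f : D → E) (i : E → E') (j : F → E')
    (Φ : Multiset E' → ℝ) (A : Multiset E → ℝ) (B : Multiset F → ℝ)
    (h : ∀ G H, Φ (G.map i + H.map j) = A G + B H) (m : ℕ) :
    ∀ G H, (avgCons (i ∘ f) ^ m) Φ (G.map i + H.map j) = (avgCons f ^ m) A G + B H := by
  induction m with
  | zero => simpa using h
  | succ m ih =>
    intro G H
    have key : ∀ d, (avgCons (i ∘ f) ^ m) Φ ((i ∘ f) d ::ₘ (G.map i + H.map j)) =
        (avgCons f ^ m) A (f d ::ₘ G) + B H := fun d => by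
      rw [← ih, Multiset.map_cons, Multiset.cons_add, Function.comp_apply]
    rw [pow_succ', pow_succ', Module.End.mul_apply, Module.End.mul_apply, avgCons_apply,
      avgCons_apply]
    simp only [key, Finset.sum_add_distrib, add_div, Finset.sum_const, Finset.card_univ,
      nsmul_eq_mul]
    rw [mul_div_cancel_left₀ _ (by exact_mod_cast Fintype.card_ne_zero)]

lemma avgCons_pow_mul_map {F : Type*} (f : D → E) (i : E → E') (j : F → E')
    (Φ : Multiset E' → ℝ) (A : Multiset E → ℝ) (B : Multiset F → ℝ)
    (h : ∀ G H, Φ (G.map i + H.map j) = A G * B H) (m : ℕ) :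
    ∀ G H, (avgCons (i ∘ f) ^ m) Φ (G.map i + H.map j) = (avgCons f ^ m) A G * B H := by
  induction m with
  | zero => simpa using h
  | succ m ih =>
    intro G H
    have key : ∀ d, (avgCons (i ∘ f) ^ m) Φ ((i ∘ f) d ::ₘ (G.map i + H.map j)) =
        (avgCons f ^ m) A (f d ::ₘ G) * B H := fun d => by
      rw [← ih, Multiset.map_cons, Multiset.cons_add, Function.comp_apply]
    rw [pow_succ', pow_succ', Module.End.mul_apply, Module.End.mul_apply, avgCons_apply,
      avgCons_apply]
    simp only [key, ← Finset.sum_mul, div_mul_eq_mul_div]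

/-- If averaging along `f` dominates, at `Φ`, the mixture of the averages along `g` and `h`, then
`M` independent draws along `f` dominate the mixture of `k` draws along `g` and `M - k` along `h`,
with `k` binomial. -/
lemma sum_binomial_le_avgCons_pow {D₁ D₂ : Type*} [Fintype D₁] [Fintype D₂] (f : D → E)
    (g : D₁ → E) (h : D₂ → E) {θ : ℝ} (h0 : 0 ≤ θ) (h1 : θ ≤ 1) {Φ : Multiset E → ℝ}
    (hΦ : (θ • avgCons g + (1 - θ) • avgCons h) Φ ≤ avgCons f Φ) (M : ℕ) (G : Multiset E) :
    ∑ k ∈ Finset.range (M + 1), (M.choose k * θ ^ k * (1 - θ) ^ (M - k)) *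
      (avgCons g ^ k) ((avgCons h ^ (M - k)) Φ) G ≤ (avgCons f ^ M) Φ G := by
  have hmono : Monotone (θ • avgCons g + (1 - θ) • avgCons h) := by
    intro Φ Ψ hΦΨ
    have := avgCons_monotone g hΦΨ
    have := avgCons_monotone h hΦΨ
    simp only [LinearMap.add_apply, LinearMap.smul_apply]
    have := sub_nonneg.2 h1
    gcongr
  have hcomm : Commute (θ • avgCons g + (1 - θ) • avgCons h) (avgCons f) :=
    ((avgCons_commute g f).smul_left θ).add_left ((avgCons_commute h f).smul_left _)
  refine le_trans (le_of_eq ?_) (pow_apply_le_pow_apply hmono (avgCons_monotone f) hcomm hΦ M G)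
  rw [(((avgCons_commute g h).smul_left θ).smul_right (1 - θ)).add_pow, LinearMap.sum_apply,
    Finset.sum_apply]
  refine Finset.sum_congr rfl fun k _ => ?_
  rw [smul_pow, smul_pow, smul_mul_smul_comm, ← nsmul_eq_mul', LinearMap.smul_apply,
    LinearMap.smul_apply, Module.End.mul_apply]
  simp only [Pi.smul_apply, nsmul_eq_mul, smul_eq_mul]
  ring

end avgCons

namespace ConstraintModel

/-! ### Violated constraints -/

variable (m : ConstraintModel) {V W : Type}

/-- A labelled hyperedge on the node set `V`. -/
abbrev Clause (V : Type) : Type := (Fin m.K → V) × m.Label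

/-- The hyperedge `e` has value `0` under the assignment `x`. -/
def Violates (e : m.Clause V) (x : V → Fin m.q) : Prop := m.edgePot e.2 (x ∘ e.1) = 0

/-- The image of a hyperedge under a map of the nodes. -/
def mapClause (g : V → W) (e : m.Clause V) : m.Clause W := (g ∘ e.1, e.2)

open Classical in
/-- The number of hyperedges of `G` with value `0` under `x`. -/
noncomputable def numViolated (G : Multiset (m.Clause V)) (x : V → Fin m.q) : ℕ :=
  G.countP fun e => m.Violates e x

/-- The least number of hyperedges with value `0` under an assignment. -/
noncomputable def minViolated (G : Multiset (m.Clause V)) : ℕ := ⨅ x, m.numViolated G x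

open Classical in
/-- The indicator that all assignments of `O` violate `e`. -/
noncomputable def frozenInd (O : Set (V → Fin m.q)) (e : m.Clause V) : ℝ :=
  if ∀ x ∈ O, m.Violates e x then 1 else 0

lemma minViolated_le (G : Multiset (m.Clause V)) (x : V → Fin m.q) :
    m.minViolated G ≤ m.numViolated G x :=
  ciInf_le (OrderBot.bddBelow _) x

lemma exists_numViolated_eq (hq : 0 < m.q) (G : Multiset (m.Clause V)) :
    ∃ x, m.numViolated G x = m.minViolated G :=
  haveI : Nonempty (V → Fin m.q) := ⟨fun _ => ⟨0, hq⟩⟩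
  ciInf_mem (m.numViolated G)

open Classical in
lemma numViolated_cons (e : m.Clause V) (G : Multiset (m.Clause V)) (x : V → Fin m.q) :
    m.numViolated (e ::ₘ G) x = m.numViolated G x + if m.Violates e x then 1 else 0 :=
  Multiset.countP_cons _ _ _

lemma numViolated_add (G H : Multiset (m.Clause V)) (x : V → Fin m.q) :
    m.numViolated (G + H) x = m.numViolated G x + m.numViolated H x :=
  by classical exact Multiset.countP_add _ _ _

lemma numViolated_map (g : V → W) (G : Multiset (m.Clause V)) (x : W → Fin m.q) :
    m.numViolated (G.map (m.mapClause g)) x = m.numViolated G (x ∘ g) := by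
  induction G using Multiset.induction_on with
  | empty => simp [numViolated]
  | cons e G ih =>
    rw [Multiset.map_cons, numViolated_cons, numViolated_cons, ih]
    rfl

open Classical in
/-- Adding a hyperedge raises the least number of violated hyperedges by one exactly when every
optimal assignment violates it. -/
lemma minViolated_cons (hq : 0 < m.q) (e : m.Clause V) (G : Multiset (m.Clause V)) :
    m.minViolated (e ::ₘ G) = m.minViolated G +
      if ∀ x ∈ {x | m.numViolated G x = m.minViolated G}, m.Violates e x then 1 else 0 := by
  obtain ⟨y, hy⟩ := m.exists_numViolated_eq hq (e ::ₘ G)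
  obtain ⟨z, hz⟩ := m.exists_numViolated_eq hq G
  have hy' := m.numViolated_cons e G y
  have hyG := m.minViolated_le G y
  split_ifs with h
  · have h1 := m.minViolated_le (e ::ₘ G) z
    rw [numViolated_cons, if_pos (h z hz)] at h1
    by_cases hyO : m.numViolated G y = m.minViolated G
    · rw [if_pos (h y hyO)] at hy'
      omega
    · split_ifs at hy' <;> omega
  · push Not at h
    obtain ⟨w, hw, hwe⟩ := h
    have h1 := m.minViolated_le (e ::ₘ G) w
    rw [numViolated_cons, if_neg hwe, show m.numViolated G w = _ from hw] at h1
    omega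

lemma minViolated_sum (hq : 0 < m.q) (G : Multiset (m.Clause V)) (H : Multiset (m.Clause W)) :
    m.minViolated (G.map (m.mapClause Sum.inl) + H.map (m.mapClause Sum.inr)) =
      m.minViolated G + m.minViolated H := by
  apply le_antisymm
  · obtain ⟨x, hx⟩ := m.exists_numViolated_eq hq G
    obtain ⟨y, hy⟩ := m.exists_numViolated_eq hq H
    refine (m.minViolated_le _ (Sum.elim x y)).trans ?_
    rw [numViolated_add, numViolated_map, numViolated_map, Sum.elim_comp_inl, Sum.elim_comp_inr,
      hx, hy]
  · obtain ⟨x, hx⟩ := m.exists_numViolated_eq hq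
      (G.map (m.mapClause Sum.inl) + H.map (m.mapClause Sum.inr))
    rw [← hx, numViolated_add, numViolated_map, numViolated_map]
    exact add_le_add (m.minViolated_le _ _) (m.minViolated_le _ _)

lemma minViolated_map_equiv (hq : 0 < m.q) (g : V ≃ W) (G : Multiset (m.Clause V)) :
    m.minViolated (G.map (m.mapClause g)) = m.minViolated G := by
  apply le_antisymm
  · obtain ⟨x, hx⟩ := m.exists_numViolated_eq hq G
    refine (m.minViolated_le _ (x ∘ g.symm)).trans ?_
    rw [numViolated_map, ← hx, Function.comp_assoc, Equiv.symm_comp_self, Function.comp_id]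
  · obtain ⟨x, hx⟩ := m.exists_numViolated_eq hq (G.map (m.mapClause g))
    rw [← hx, numViolated_map]
    exact m.minViolated_le _ _

lemma abs_minViolated_cons_sub_le (hq : 0 < m.q) (e : m.Clause V) (G : Multiset (m.Clause V)) :
    |(m.minViolated (e ::ₘ G) : ℝ) - m.minViolated G| ≤ 1 := by
  classical
  rw [minViolated_cons m hq]
  split_ifs <;> simp

open Classical in
/-- The properties of a model that the scaling limits depend on. The edge potentials are `0` or `1`.
For any nonempty set `O` of assignments, the number of labels for which all of `O` violates the
hyperedge with nodes `e` is a positive combination of product functions of `e`. Every assignment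
violates a fixed proportion of all hyperedges. With at least two values and two nodes, some
hyperedge can be satisfied. -/
structure IsConvex : Prop where
  edgePot_eq : ∀ a y, m.edgePot a y = 0 ∨ m.edgePot a y = 1
  q_pos : 0 < m.q
  frozen : ∀ (V : Type) [Fintype V] (O : Set (V → Fin m.q)), O.Nonempty →
    ∃ (ι : Type) (_ : Fintype ι) (κ : ℝ) (f : ι → V → ℝ), 0 ≤ κ ∧ (∀ i v, 0 ≤ f i v) ∧
      ∀ e : Fin m.K → V, ∑ a, m.frozenInd O (e, a) =
        κ * ∑ i, ∏ k, f i (e k)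
  density : ∃ δ : ℝ, 0 < δ ∧ ∀ (V : Type) [Fintype V] [Nonempty V] (x : V → Fin m.q),
    δ * Fintype.card (m.Clause V) ≤ ∑ e : m.Clause V, if m.Violates e x then (1 : ℝ) else 0
  satisfiable : 2 ≤ m.q → ∀ N : ℕ, 2 ≤ N → ∃ (e : m.Clause (Fin N)) (x : Fin N → Fin m.q),
    ¬ m.Violates e x

/-! ### Interpolation between a hypergraph and two disjoint hypergraphs -/

variable {m}

/-- The proportion of violated hyperedges with nodes in the image of `g`, as a sum of powers. -/
lemma IsConvex.proportion_eq [Fintype V] {O : Set (W → Fin m.q)} {ι : Type}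
    [Fintype ι] {κ : ℝ} {f : ι → W → ℝ}
    (hf : ∀ e : Fin m.K → W, ∑ a, m.frozenInd O (e, a) =
        κ * ∑ i, ∏ k, f i (e k)) (g : V → W) :
    (∑ e : m.Clause V, m.frozenInd O (m.mapClause g e)) /
        Fintype.card (m.Clause V) =
      κ / Fintype.card m.Label * ∑ i, ((∑ v, f i (g v)) / Fintype.card V) ^ m.K := by
  rw [Fintype.sum_prod_type]
  simp only [mapClause, hf]
  rw [← Finset.mul_sum, Finset.sum_comm]
  simp only [div_pow, Function.comp_apply, Fintype.sum_pow, Fintype.card_prod, Fintype.card_fun,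
    Fintype.card_fin, Nat.cast_mul, Nat.cast_pow]
  rw [← Finset.sum_div]
  ring

/-- One step of the interpolation: a uniform hyperedge on the union of two node sets violates all
optimal assignments less often than one inside the first or the second part, chosen in
proportion to their sizes. This is the convexity of `t ↦ t ^ K`. -/
lemma IsConvex.avgCons_step [Fintype V] [Fintype W] [Nonempty V] [Nonempty W] (hm : m.IsConvex)
    {φ : ℕ → ℝ} (hφ : Antitone φ) {θ : ℝ}
    (hθ : θ = (Fintype.card V : ℝ) / (Fintype.card V + Fintype.card W)) :
    (θ • avgCons (m.mapClause (Sum.inl : V → V ⊕ W)) +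
        (1 - θ) • avgCons (m.mapClause (Sum.inr : W → V ⊕ W))) (fun G => φ (m.minViolated G)) ≤
      avgCons (id : m.Clause (V ⊕ W) → m.Clause (V ⊕ W)) (fun G => φ (m.minViolated G)) := by
  classical
  intro G
  set O := {x | m.numViolated G x = m.minViolated G} with hO
  obtain ⟨ι, _, κ, f, hκ, hf0, hf⟩ := hm.frozen _ O (m.exists_numViolated_eq hm.q_pos G)
  have hV : (0 : ℝ) < Fintype.card V := by exact_mod_cast Fintype.card_pos
  have hW : (0 : ℝ) < Fintype.card W := by exact_mod_cast Fintype.card_pos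
  have expand : ∀ {U : Type} [Fintype U] [Nonempty U] (g : U → V ⊕ W),
      avgCons (m.mapClause g) (fun G => φ (m.minViolated G)) G = φ (m.minViolated G) -
        (φ (m.minViolated G) - φ (m.minViolated G + 1)) * (κ / Fintype.card m.Label *
          ∑ i, ((∑ v, f i (g v)) / Fintype.card U) ^ m.K) := by
    intro U _ _ g
    have hU : (Fintype.card (m.Clause U) : ℝ) ≠ 0 := by exact_mod_cast Fintype.card_ne_zero
    rw [← IsConvex.proportion_eq hf g, avgCons_apply, mul_div_assoc', eq_sub_iff_add_eq, ← add_div,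
      div_eq_iff hU, Finset.mul_sum, ← Finset.sum_add_distrib]
    have : ∀ e : m.Clause U, φ (m.minViolated (m.mapClause g e ::ₘ G)) +
        (φ (m.minViolated G) - φ (m.minViolated G + 1)) *
          m.frozenInd O (m.mapClause g e) =
        φ (m.minViolated G) := by
      intro e
      rw [minViolated_cons m hm.q_pos, frozenInd]
      split_ifs <;> simp
    rw [Finset.sum_congr rfl fun e _ => this e]
    simp [mul_comm]
  have hid : (id : m.Clause (V ⊕ W) → m.Clause (V ⊕ W)) = m.mapClause id := rfl
  simp only [hid, LinearMap.add_apply, LinearMap.smul_apply, Pi.add_apply, Pi.smul_apply,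
    smul_eq_mul, expand]
  have hΔ : 0 ≤ φ (m.minViolated G) - φ (m.minViolated G + 1) :=
    sub_nonneg.2 (hφ (Nat.le_succ _))
  have hκ' : 0 ≤ κ / Fintype.card m.Label := by positivity
  have hθ0 : 0 ≤ θ := by rw [hθ]; positivity
  have hθ1 : 1 - θ = (Fintype.card W : ℝ) / (Fintype.card V + Fintype.card W) := by
    rw [hθ]; field_simp; ring
  have hθ10 : 0 ≤ 1 - θ := by rw [hθ1]; positivity
  have key : ∑ i, ((∑ v, f i (id v)) / Fintype.card (V ⊕ W)) ^ m.K ≤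
      θ * ∑ i, ((∑ v : V, f i (Sum.inl v)) / Fintype.card V) ^ m.K +
      (1 - θ) * ∑ i, ((∑ v : W, f i (Sum.inr v)) / Fintype.card W) ^ m.K := by
    rw [Finset.mul_sum, Finset.mul_sum, ← Finset.sum_add_distrib]
    refine Finset.sum_le_sum fun i _ => ?_
    have h1 : 0 ≤ (∑ v : V, f i (Sum.inl v)) / Fintype.card V :=
      div_nonneg (Finset.sum_nonneg fun _ _ => hf0 _ _) hV.le
    have h2 : 0 ≤ (∑ v : W, f i (Sum.inr v)) / Fintype.card W :=
      div_nonneg (Finset.sum_nonneg fun _ _ => hf0 _ _) hW.le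
    have := (convexOn_pow m.K).2 (Set.mem_Ici.2 h1) (Set.mem_Ici.2 h2) hθ0 hθ10 (by ring)
    refine le_trans (le_of_eq ?_) this
    congr 1
    rw [hθ1, hθ, Fintype.sum_sum_type, Fintype.card_sum]
    push_cast
    simp only [id, smul_eq_mul]
    field_simp
  have := mul_le_mul_of_nonneg_left (mul_le_mul_of_nonneg_left key hκ') hΔ
  linear_combination this

end ConstraintModel

namespace ConstraintModel

variable {m : ConstraintModel} {V W : Type}

/-! ### Expected number of violated hyperedges and probability of satisfiability -/

variable (m) in
/-- The expectation of `Φ` at the multiset of `M` independent uniform hyperedges on `V`. -/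
noncomputable def expect (V : Type) [Fintype V] (M : ℕ) (Φ : Multiset (m.Clause V) → ℝ) : ℝ :=
  (avgCons (id : m.Clause V → m.Clause V) ^ M) Φ 0

variable (m) in
/-- The expectation of the least number of violated hyperedges. -/
noncomputable def meanViolated (N M : ℕ) : ℝ :=
  m.expect (Fin N) M fun G => (m.minViolated G : ℝ)

/-- The indicator of `0`, a function of the least number of violated hyperedges. -/
noncomputable def indZero (k : ℕ) : ℝ := if k = 0 then 1 else 0

lemma indZero_antitone : Antitone indZero := by
  intro a b h
  unfold indZero
  split_ifs <;> first | omega | norm_num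

lemma indZero_add (a b : ℕ) : indZero (a + b) = indZero a * indZero b := by
  unfold indZero
  split_ifs <;> first | omega | norm_num

lemma indZero_nonneg (a : ℕ) : 0 ≤ indZero a := by
  unfold indZero
  split_ifs <;> norm_num

variable (m) in
/-- The probability that some assignment violates no hyperedge. -/
noncomputable def probSat (N M : ℕ) : ℝ :=
  m.expect (Fin N) M fun G => indZero (m.minViolated G)

lemma expect_mono [Fintype V] (M : ℕ) {Φ Ψ : Multiset (m.Clause V) → ℝ} (h : ∀ G, Φ G ≤ Ψ G) :
    m.expect V M Φ ≤ m.expect V M Ψ :=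
  monotone_end_pow (avgCons_monotone _) M h 0

lemma expect_const [Fintype V] [Nonempty V] (M : ℕ) (c : ℝ) : m.expect V M (fun _ => c) = c :=
  congrFun (avgCons_pow_const _ c M) 0

lemma expect_add [Fintype V] (M : ℕ) (Φ Ψ : Multiset (m.Clause V) → ℝ) :
    m.expect V M (fun G => Φ G + Ψ G) = m.expect V M Φ + m.expect V M Ψ :=
  congrFun (map_add (avgCons (id : m.Clause V → m.Clause V) ^ M) Φ Ψ) 0

lemma expect_mul_left [Fintype V] (M : ℕ) (c : ℝ) (Φ : Multiset (m.Clause V) → ℝ) :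
    m.expect V M (fun G => c * Φ G) = c * m.expect V M Φ :=
  congrFun (map_smul (avgCons (id : m.Clause V → m.Clause V) ^ M) c Φ) 0

lemma expect_succ [Fintype V] (M : ℕ) (Φ : Multiset (m.Clause V) → ℝ) :
    m.expect V (M + 1) Φ = m.expect V M (avgCons id Φ) := by
  rw [expect, pow_succ, Module.End.mul_apply, expect]

lemma expect_minViolated_equiv [Fintype V] [Fintype W] (hq : 0 < m.q) (g : V ≃ W) (M : ℕ)
    (φ : ℕ → ℝ) : m.expect W M (fun G => φ (m.minViolated G)) =
      m.expect V M fun G => φ (m.minViolated G) := by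
  let g' : m.Clause V ≃ m.Clause W := ((Equiv.refl (Fin m.K)).arrowCongr g).prodCongr (Equiv.refl _)
  have hg' : (g' : m.Clause V → m.Clause W) = m.mapClause g := rfl
  have := avgCons_pow_equiv g' (fun G => φ (m.minViolated G)) M 0
  simp only [hg', minViolated_map_equiv m hq] at this
  exact this

/-- The interpolation inequality for antitone functions of the least number of violated
hyperedges. -/
lemma IsConvex.sum_binomial_le_expect (hm : m.IsConvex) {N₁ N₂ : ℕ} (h₁ : 0 < N₁) (h₂ : 0 < N₂)
    (M : ℕ) {θ : ℝ} (hθ : θ = (N₁ : ℝ) / (N₁ + N₂)) {φ : ℕ → ℝ} (hφ : Antitone φ) :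
    ∑ k ∈ Finset.range (M + 1), (M.choose k * θ ^ k * (1 - θ) ^ (M - k)) *
      (avgCons (m.mapClause (Sum.inl : Fin N₁ → Fin N₁ ⊕ Fin N₂) ∘ id) ^ k)
        ((avgCons (m.mapClause (Sum.inr : Fin N₂ → Fin N₁ ⊕ Fin N₂) ∘ id) ^ (M - k))
          fun G => φ (m.minViolated G)) 0 ≤
    m.expect (Fin (N₁ + N₂)) M fun G => φ (m.minViolated G) := by
  have := Fin.pos_iff_nonempty.1 h₁
  have := Fin.pos_iff_nonempty.1 h₂
  have hθ0 : 0 ≤ θ := by rw [hθ]; positivity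
  have hθ1 : θ ≤ 1 := by rw [hθ]; exact div_le_one_of_le₀ (by simp) (by positivity)
  rw [expect_minViolated_equiv hm.q_pos (finSumFinEquiv (m := N₁) (n := N₂)) M φ]
  exact sum_binomial_le_avgCons_pow _ _ _ hθ0 hθ1
    (hm.avgCons_step (V := Fin N₁) (W := Fin N₂) hφ (by simpa using hθ)) M 0

lemma IsConvex.meanViolated_le (hm : m.IsConvex) {N₁ N₂ : ℕ} (h₁ : 0 < N₁) (h₂ : 0 < N₂) (M : ℕ)
    {θ : ℝ} (hθ : θ = (N₁ : ℝ) / (N₁ + N₂)) :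
    m.meanViolated (N₁ + N₂) M ≤ ∑ k ∈ Finset.range (M + 1),
      (M.choose k * θ ^ k * (1 - θ) ^ (M - k)) *
        (m.meanViolated N₁ k + m.meanViolated N₂ (M - k)) := by
  have := Fin.pos_iff_nonempty.1 h₁
  have := Fin.pos_iff_nonempty.1 h₂
  have hφ : Antitone fun k : ℕ => (-1) * (k : ℝ) := fun a b h => by simpa using h
  have h := hm.sum_binomial_le_expect h₁ h₂ M hθ hφ
  rw [expect_mul_left] at h
  have key : ∀ k, (avgCons (m.mapClause (Sum.inl : Fin N₁ → Fin N₁ ⊕ Fin N₂) ∘ id) ^ k)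
      ((avgCons (m.mapClause (Sum.inr : Fin N₂ → Fin N₁ ⊕ Fin N₂) ∘ id) ^ (M - k))
        fun G => (-1) * (m.minViolated G : ℝ)) 0 =
      -(m.meanViolated N₁ k + m.meanViolated N₂ (M - k)) := by
    intro k
    have h1 := avgCons_pow_add_map (id : m.Clause (Fin N₂) → _)
      (m.mapClause (Sum.inr : Fin N₂ → Fin N₁ ⊕ Fin N₂)) (m.mapClause Sum.inl)
      (fun G => (-1) * (m.minViolated G : ℝ)) (fun G => (-1) * (m.minViolated G : ℝ))
      (fun G => (-1) * (m.minViolated G : ℝ)) (fun G H => by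
        rw [add_comm (G.map _), minViolated_sum m hm.q_pos]
        push_cast
        ring) (M - k)
    have h2 := avgCons_pow_add_map (id : m.Clause (Fin N₁) → _)
      (m.mapClause (Sum.inl : Fin N₁ → Fin N₁ ⊕ Fin N₂)) (m.mapClause Sum.inr)
      _ _ _ (fun G H => by
        have h := h1 H G
        rw [add_comm (Multiset.map _ H)] at h
        exact h.trans (add_comm _ _)) k 0 0
    rw [Multiset.map_zero, Multiset.map_zero, add_zero] at h2
    rw [h2]
    change m.expect _ _ _ + m.expect _ _ _ = _
    rw [expect_mul_left, expect_mul_left, meanViolated, meanViolated]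
    ring
  simp only [key, mul_neg, Finset.sum_neg_distrib] at h
  rw [meanViolated]
  linarith

lemma IsConvex.le_probSat (hm : m.IsConvex) {N₁ N₂ : ℕ} (h₁ : 0 < N₁) (h₂ : 0 < N₂) (M : ℕ)
    {θ : ℝ} (hθ : θ = (N₁ : ℝ) / (N₁ + N₂)) :
    ∑ k ∈ Finset.range (M + 1), (M.choose k * θ ^ k * (1 - θ) ^ (M - k)) *
        (m.probSat N₁ k * m.probSat N₂ (M - k)) ≤ m.probSat (N₁ + N₂) M := by
  refine le_trans (le_of_eq ?_) (hm.sum_binomial_le_expect h₁ h₂ M hθ indZero_antitone)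
  refine Finset.sum_congr rfl fun k _ => ?_
  congr 1
  have h1 := avgCons_pow_mul_map (id : m.Clause (Fin N₂) → _)
    (m.mapClause (Sum.inr : Fin N₂ → Fin N₁ ⊕ Fin N₂)) (m.mapClause Sum.inl)
    (fun G => indZero (m.minViolated G)) (fun G => indZero (m.minViolated G))
    (fun G => indZero (m.minViolated G)) (fun G H => by
      rw [add_comm (G.map _), minViolated_sum m hm.q_pos, indZero_add, mul_comm]) (M - k)
  have h2 := avgCons_pow_mul_map (id : m.Clause (Fin N₁) → _)
    (m.mapClause (Sum.inl : Fin N₁ → Fin N₁ ⊕ Fin N₂)) (m.mapClause Sum.inr)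
    _ _ _ (fun G H => by
      have h := h1 H G
      rw [add_comm (Multiset.map _ H)] at h
      exact h.trans (mul_comm _ _)) k 0 0
  rw [Multiset.map_zero, Multiset.map_zero, add_zero] at h2
  rw [h2]
  rfl

/-! ### Monotonicity and the first moment bound -/

lemma avgCons_le_of_le [Fintype V] [Nonempty V] {Φ : Multiset (m.Clause V) → ℝ}
    {G : Multiset (m.Clause V)} {c : ℝ} (h : ∀ e, Φ (e ::ₘ G) ≤ c) : avgCons id Φ G ≤ c := by
  have hD : (0 : ℝ) < Fintype.card (m.Clause V) := by exact_mod_cast Fintype.card_pos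
  rw [avgCons_apply, div_le_iff₀ hD]
  calc ∑ e, Φ (id e ::ₘ G) ≤ ∑ _e : m.Clause V, c := Finset.sum_le_sum fun e _ => h e
    _ = c * Fintype.card (m.Clause V) := by simp [mul_comm]

lemma le_avgCons_of_le [Fintype V] [Nonempty V] {Φ : Multiset (m.Clause V) → ℝ}
    {G : Multiset (m.Clause V)} {c : ℝ} (h : ∀ e, c ≤ Φ (e ::ₘ G)) : c ≤ avgCons id Φ G := by
  have hD : (0 : ℝ) < Fintype.card (m.Clause V) := by exact_mod_cast Fintype.card_pos
  rw [avgCons_apply, le_div_iff₀ hD]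
  calc c * Fintype.card (m.Clause V) = ∑ _e : m.Clause V, c := by simp [mul_comm]
    _ ≤ ∑ e, Φ (id e ::ₘ G) := Finset.sum_le_sum fun e _ => h e

lemma minViolated_le_cons (hq : 0 < m.q) (e : m.Clause V) (G : Multiset (m.Clause V)) :
    m.minViolated G ≤ m.minViolated (e ::ₘ G) := by
  classical
  rw [minViolated_cons m hq]
  exact Nat.le_add_right _ _

lemma minViolated_cons_le (hq : 0 < m.q) (e : m.Clause V) (G : Multiset (m.Clause V)) :
    m.minViolated (e ::ₘ G) ≤ m.minViolated G + 1 := by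
  classical
  rw [minViolated_cons m hq]
  split_ifs <;> omega

lemma IsConvex.meanViolated_mono (hm : m.IsConvex) {N : ℕ} (hN : 0 < N) :
    Monotone (m.meanViolated N) := by
  have := Fin.pos_iff_nonempty.1 hN
  refine monotone_nat_of_le_succ fun M => ?_
  rw [meanViolated, meanViolated, expect_succ]
  refine expect_mono M fun G => le_avgCons_of_le fun e => ?_
  exact_mod_cast minViolated_le_cons hm.q_pos e G

lemma IsConvex.meanViolated_succ_le (hm : m.IsConvex) {N : ℕ} (hN : 0 < N) (M : ℕ) :
    m.meanViolated N (M + 1) ≤ m.meanViolated N M + 1 := by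
  have := Fin.pos_iff_nonempty.1 hN
  have h1 := expect_const (m := m) (V := Fin N) M 1
  conv_rhs => rw [← h1]
  rw [meanViolated, meanViolated, expect_succ, ← expect_add]
  refine expect_mono M fun G => avgCons_le_of_le fun e => ?_
  exact_mod_cast minViolated_cons_le hm.q_pos e G

lemma IsConvex.abs_meanViolated_sub_le (hm : m.IsConvex) {N : ℕ} (hN : 0 < N) (M M' : ℕ) :
    |m.meanViolated N M - m.meanViolated N M'| ≤ |(M : ℝ) - M'| := by
  have hanti : Antitone fun M : ℕ => m.meanViolated N M - M := antitone_nat_of_succ_le fun M => by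
    have := hm.meanViolated_succ_le hN M
    push_cast
    linarith
  wlog h : M' ≤ M generalizing M M'
  · rw [abs_sub_comm, abs_sub_comm (M : ℝ)]
    exact this M' M (by omega)
  have h1 := hanti h
  have h2 := hm.meanViolated_mono hN h
  have h3 : (M' : ℝ) ≤ M := by exact_mod_cast h
  simp only at h1
  rw [abs_of_nonneg (by linarith), abs_of_nonneg (by linarith)]
  linarith

lemma IsConvex.probSat_antitone (hm : m.IsConvex) {N : ℕ} (hN : 0 < N) :
    Antitone (m.probSat N) := by
  have := Fin.pos_iff_nonempty.1 hN
  refine antitone_nat_of_succ_le fun M => ?_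
  rw [probSat, probSat, expect_succ]
  exact expect_mono M fun G => avgCons_le_of_le fun e =>
    indZero_antitone (minViolated_le_cons hm.q_pos e G)

lemma meanViolated_nonneg {N : ℕ} (hN : 0 < N) (M : ℕ) :
    0 ≤ m.meanViolated N M := by
  have := Fin.pos_iff_nonempty.1 hN
  rw [← expect_const (m := m) (V := Fin N) M 0]
  exact expect_mono M fun G => Nat.cast_nonneg _

lemma probSat_le_one {N : ℕ} (hN : 0 < N) (M : ℕ) : m.probSat N M ≤ 1 := by
  have := Fin.pos_iff_nonempty.1 hN
  rw [← expect_const (m := m) (V := Fin N) M 1]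
  refine expect_mono M fun G => ?_
  unfold indZero
  split_ifs <;> norm_num

/-- Repeating one satisfiable hyperedge gives a satisfiable instance, so satisfiability has positive
probability. -/
lemma IsConvex.probSat_pos (hm : m.IsConvex) (hq : 2 ≤ m.q) {N : ℕ} (hN : 2 ≤ N) (M : ℕ) :
    0 < m.probSat N M := by
  obtain ⟨e, x, hex⟩ := hm.satisfiable hq N hN
  have hn : Nonempty (Fin N) := Fin.pos_iff_nonempty.1 (by omega)
  have hD : (0 : ℝ) < Fintype.card (m.Clause (Fin N)) := by exact_mod_cast Fintype.card_pos
  have hnonneg : ∀ M, ∀ G : Multiset (m.Clause (Fin N)), 0 ≤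
      (avgCons (id : m.Clause (Fin N) → _) ^ M) (fun G => indZero (m.minViolated G)) G :=
    fun M G => by
      rw [← congrFun (avgCons_pow_const (id : m.Clause (Fin N) → _) 0 M) G]
      exact monotone_end_pow (avgCons_monotone _) M (fun _ => indZero_nonneg _) G
  have key : ∀ G : Multiset (m.Clause (Fin N)), m.numViolated G x = 0 → 0 <
      (avgCons (id : m.Clause (Fin N) → _) ^ M) (fun G => indZero (m.minViolated G)) G := by
    induction M with
    | zero =>
      intro G hG
      have : m.minViolated G = 0 := Nat.le_zero.1 (hG ▸ m.minViolated_le G x)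
      simp [indZero, this]
    | succ M ih =>
      intro G hG
      rw [pow_succ', Module.End.mul_apply, avgCons_apply]
      refine div_pos (Finset.sum_pos' (fun _ _ => hnonneg M _) ⟨e, Finset.mem_univ _, ih _ ?_⟩) hD
      rw [id, numViolated_cons, hG, if_neg hex]
  exact key 0 (by simp [numViolated])

/-- The first moment bound for the exponential of minus the number of violated hyperedges. -/
lemma IsConvex.exists_expect_exp_le (hm : m.IsConvex) : ∃ B : ℝ, 0 < B ∧
    ∀ N M : ℕ, 0 < N → m.expect (Fin N) M (fun G => Real.exp (-(m.minViolated G : ℝ))) ≤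
      Real.exp (N * Real.log m.q - B * M) := by
  classical
  obtain ⟨δ, hδ, hdens⟩ := hm.density
  have he : Real.exp (-1) < 1 := by simp
  refine ⟨δ * (1 - Real.exp (-1)), mul_pos hδ (by linarith), fun N M hN => ?_⟩
  set B := δ * (1 - Real.exp (-1)) with hB
  have hn := Fin.pos_iff_nonempty.1 hN
  have hD : (0 : ℝ) < Fintype.card (m.Clause (Fin N)) := by exact_mod_cast Fintype.card_pos
  have step : ∀ x : Fin N → Fin m.q, avgCons (id : m.Clause (Fin N) → _)
      (fun G => Real.exp (-(m.numViolated G x : ℝ))) ≤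
        Real.exp (-B) • fun G => Real.exp (-(m.numViolated G x : ℝ)) := by
    intro x G
    rw [avgCons_apply, Pi.smul_apply, smul_eq_mul, div_le_iff₀ hD]
    have h1 : ∀ e : m.Clause (Fin N), Real.exp (-(m.numViolated (id e ::ₘ G) x : ℝ)) =
        Real.exp (-(m.numViolated G x : ℝ)) *
          (1 - (1 - Real.exp (-1)) * if m.Violates e x then (1 : ℝ) else 0) := by
      intro e
      rw [id, numViolated_cons]
      split_ifs
      · rw [mul_one, sub_sub_cancel, ← Real.exp_add]
        push_cast
        ring_nf
      · simp
    rw [Finset.sum_congr rfl fun e _ => h1 e, ← Finset.mul_sum, Finset.sum_sub_distrib,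
      ← Finset.mul_sum, Finset.sum_const, Finset.card_univ, nsmul_eq_mul, mul_one]
    have h2 := hdens (Fin N) x
    have h3 : 1 - B ≤ Real.exp (-B) := by linarith [Real.add_one_le_exp (-B)]
    have h4 := mul_le_mul_of_nonneg_left h2 (sub_nonneg.2 he.le)
    have h5 := mul_le_mul_of_nonneg_right h3 hD.le
    rw [mul_comm (Real.exp (-B)), mul_assoc]
    refine mul_le_mul_of_nonneg_left ?_ (Real.exp_pos _).le
    rw [hB] at h5 ⊢
    linarith
  have hpow : ∀ x : Fin N → Fin m.q, m.expect (Fin N) M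
      (fun G => Real.exp (-(m.numViolated G x : ℝ))) ≤ Real.exp (-B) ^ M := by
    intro x
    induction M with
    | zero => simp [expect, numViolated]
    | succ M ih =>
      rw [expect_succ]
      calc _ ≤ m.expect (Fin N) M (fun G => Real.exp (-B) * Real.exp (-(m.numViolated G x : ℝ))) :=
            expect_mono M fun G => step x G
        _ ≤ Real.exp (-B) ^ (M + 1) := by
          rw [expect_mul_left, pow_succ']
          exact mul_le_mul_of_nonneg_left ih (Real.exp_pos _).le
  have hsum : m.expect (Fin N) M
      (fun G => ∑ x : Fin N → Fin m.q, Real.exp (-(m.numViolated G x : ℝ))) =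
      ∑ x : Fin N → Fin m.q, m.expect (Fin N) M fun G => Real.exp (-(m.numViolated G x : ℝ)) := by
    have : (fun G => ∑ x : Fin N → Fin m.q, Real.exp (-(m.numViolated G x : ℝ))) =
        ∑ x : Fin N → Fin m.q, fun G => Real.exp (-(m.numViolated G x : ℝ)) := by
      funext G
      simp
    rw [this, expect, map_sum, Finset.sum_apply]
    rfl
  calc _ ≤ m.expect (Fin N) M
        (fun G => ∑ x : Fin N → Fin m.q, Real.exp (-(m.numViolated G x : ℝ))) :=
        expect_mono M fun G => by
          obtain ⟨x, hx⟩ := m.exists_numViolated_eq hm.q_pos G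
          rw [← hx]
          exact Finset.single_le_sum (f := fun x => Real.exp (-(m.numViolated G x : ℝ)))
            (fun _ _ => (Real.exp_pos _).le) (Finset.mem_univ x)
    _ ≤ ∑ _x : Fin N → Fin m.q, Real.exp (-B) ^ M := by
        rw [hsum]
        exact Finset.sum_le_sum fun x _ => hpow x
    _ = Real.exp (N * Real.log m.q - B * M) := by
        have hq : (0 : ℝ) < m.q := by exact_mod_cast hm.q_pos
        rw [sub_eq_add_neg, Real.exp_add, Real.exp_nat_mul, Real.exp_log hq, Finset.sum_const,
          Finset.card_univ, Fintype.card_fun, Fintype.card_fin, Fintype.card_fin, nsmul_eq_mul,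
          Nat.cast_pow, ← Real.exp_nat_mul]
        ring_nf

lemma IsConvex.exists_le_meanViolated (hm : m.IsConvex) : ∃ A B : ℝ, 0 < B ∧
    ∀ N M : ℕ, 0 < N → B * M - A * N ≤ m.meanViolated N M := by
  obtain ⟨B, hB, h⟩ := hm.exists_expect_exp_le
  refine ⟨Real.log m.q, B, hB, fun N M hN => ?_⟩
  have hn := Fin.pos_iff_nonempty.1 hN
  -- Jensen's inequality for the exponential, from its tangent at the bound.
  set a := N * Real.log m.q - B * M with ha
  have h1 : m.expect (Fin N) M (fun G => (1 - a) + (-1) * (m.minViolated G : ℝ)) ≤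
      m.expect (Fin N) M
        (fun G => Real.exp (-a) * Real.exp (-(m.minViolated G : ℝ))) :=
    expect_mono M fun G => by
      rw [← Real.exp_add]
      linarith [Real.add_one_le_exp (-a + -(m.minViolated G : ℝ))]
  rw [expect_mul_left, expect_add, expect_const, expect_mul_left] at h1
  have h2 := mul_le_mul_of_nonneg_left (h N M hN) (Real.exp_pos (-a)).le
  rw [← Real.exp_add, neg_add_cancel, Real.exp_zero] at h2
  change _ + -1 * m.meanViolated N M ≤ _ at h1
  linarith

lemma IsConvex.exists_le_neg_log_probSat (hm : m.IsConvex) (hq : 2 ≤ m.q) : ∃ A B : ℝ, 0 < B ∧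
    ∀ N M : ℕ, 2 ≤ N → B * M - A * N ≤ -Real.log (m.probSat N M) := by
  obtain ⟨B, hB, h⟩ := hm.exists_expect_exp_le
  refine ⟨Real.log m.q, B, hB, fun N M hN => ?_⟩
  have h1 : m.probSat N M ≤ Real.exp (N * Real.log m.q - B * M) :=
    (expect_mono M fun G => by
      unfold indZero
      split_ifs with h0
      · simp [h0]
      · exact (Real.exp_pos _).le).trans (h N M (by omega))
  have h2 := (Real.log_le_iff_le_exp (hm.probSat_pos hq hN M)).2 h1
  linarith

end ConstraintModel

namespace ConstraintModel

variable {m : ConstraintModel}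

/-! ### The law of the random instance -/

open Classical in
lemma law_real_eq_expect (N M : ℕ) (P : Multiset (m.Clause (Fin N)) → Prop) :
    (m.law N M).real {G | P (Finset.univ.val.map G)} =
      m.expect (Fin N) M fun G => if P G then 1 else 0 := by
  let _ : Fintype (m.Instance N M) := inferInstanceAs (Fintype (Fin M → m.Clause (Fin N)))
  have hcard : Fintype.card (m.Instance N M) = Fintype.card (m.Clause (Fin N)) ^ M := by
    change Fintype.card (Fin M → m.Clause (Fin N)) = _
    rw [Fintype.card_fun, Fintype.card_fin]
  have hset : {G : m.Instance N M | P (Finset.univ.val.map G)} =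
      ((Finset.univ.filter fun G : m.Instance N M => P (Finset.univ.val.map G) : Finset _) :
        Set (m.Instance N M)) := by
    ext G
    simp
  rw [expect, ← sum_div_card_pow_eq_avgCons_pow, MeasureTheory.measureReal_def, law,
    ProbabilityTheory.uniformOn_univ, hset, MeasureTheory.Measure.count_apply_finset, hcard,
    ENNReal.toReal_div, ENNReal.toReal_natCast, ENNReal.toReal_natCast, Nat.cast_pow]
  congr 1
  simp only [add_zero]
  rw [Finset.sum_boole]
  rfl

lemma IsConvex.value_eq (hm : m.IsConvex) {N M : ℕ} (G : m.Instance N M) (x : Fin N → Fin m.q) :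
    m.value G x = M - m.numViolated (Finset.univ.val.map G) x := by
  classical
  have h : ∀ H : Multiset (m.Clause (Fin N)), (m.numViolated H x : ℝ) =
      (H.map fun e => 1 - m.edgePot e.2 (x ∘ e.1)).sum := by
    intro H
    induction H using Multiset.induction_on with
    | empty => simp [numViolated]
    | cons e H ih =>
      rw [numViolated_cons, Multiset.map_cons, Multiset.sum_cons, ← ih]
      push_cast
      rw [add_comm]
      congr 1
      unfold Violates
      rcases hm.edgePot_eq e.2 (x ∘ e.1) with h | h <;> simp [h]
  have h2 : (m.numViolated (Finset.univ.val.map G) x : ℝ) =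
      ∑ j : Fin M, (1 - m.edgePot (G j).2 (x ∘ (G j).1)) :=
    (h _).trans (congrArg Multiset.sum (Multiset.map_map _ _ _))
  rw [h2, Finset.sum_sub_distrib]
  simp [value, Function.comp_def]

lemma IsConvex.optValue_eq (hm : m.IsConvex) {N M : ℕ} (G : m.Instance N M) :
    m.optValue G = M - m.minViolated (Finset.univ.val.map G) := by
  have : Nonempty (Fin N → Fin m.q) := ⟨fun _ => ⟨0, hm.q_pos⟩⟩
  unfold optValue
  simp only [hm.value_eq]
  apply le_antisymm
  · refine ciSup_le fun x => ?_
    have : (m.minViolated (Finset.univ.val.map G) : ℝ) ≤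
        m.numViolated (Finset.univ.val.map G) x := by exact_mod_cast m.minViolated_le _ x
    linarith
  · obtain ⟨x, hx⟩ := m.exists_numViolated_eq hm.q_pos (Finset.univ.val.map G)
    rw [← hx]
    exact le_ciSup (f := fun x => (M : ℝ) - m.numViolated (Finset.univ.val.map G) x)
      (Set.finite_range _).bddAbove x

lemma IsConvex.satProb_eq (hm : m.IsConvex) (N M : ℕ) : m.satProb N M = m.probSat N M := by
  classical
  have h := law_real_eq_expect (m := m) N M fun G => m.minViolated G = 0
  rw [satProb, probSat]
  simp only [hm.optValue_eq, sub_eq_self, Nat.cast_eq_zero]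
  rw [h]
  unfold indZero
  congr!

/-- Chebyshev's inequality for the optimal value: its variance is at most `M`, since one hyperedge
changes it by at most one. -/
lemma IsConvex.law_real_le (hm : m.IsConvex) {N : ℕ} (hN : 0 < N) (M : ℕ) (h : ℝ) {ε : ℝ}
    (hε : 0 < ε) : (m.law N M).real {G | ε < |m.optValue G / (N : ℝ) - h|} ≤
      (M + (M - m.meanViolated N M - h * N) ^ 2) / (N ^ 2 * ε ^ 2) := by
  classical
  have hn := Fin.pos_iff_nonempty.1 hN
  have hN' : (0 : ℝ) < N := by exact_mod_cast hN
  set a : ℝ := M - h * N with ha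
  simp only [hm.optValue_eq]
  rw [law_real_eq_expect N M fun G => ε < |((M : ℝ) - m.minViolated G) / (N : ℝ) - h|]
  have h1 : ∀ G : Multiset (m.Clause (Fin N)),
      (if ε < |((M : ℝ) - m.minViolated G) / (N : ℝ) - h| then (1 : ℝ) else 0) ≤
      (1 / (N ^ 2 * ε ^ 2)) * ((m.minViolated G : ℝ) ^ 2 +
        ((-2 * a) * (m.minViolated G : ℝ) + a ^ 2)) := by
    intro G
    have h2 : (m.minViolated G : ℝ) ^ 2 + ((-2 * a) * (m.minViolated G : ℝ) + a ^ 2) =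
        N ^ 2 * |((M : ℝ) - m.minViolated G) / (N : ℝ) - h| ^ 2 := by
      rw [sq_abs, ha]
      field_simp
      ring
    rw [h2]
    split_ifs with h3
    · rw [one_div_mul_eq_div, one_le_div (by positivity)]
      gcongr
    · positivity
  refine (expect_mono M h1).trans ?_
  rw [expect_mul_left, expect_add, expect_add, expect_mul_left, expect_const, one_div_mul_eq_div]
  have h4 := avgCons_pow_sq_le (id : m.Clause (Fin N) → _) M (fun G => (m.minViolated G : ℝ))
    (fun e G => m.abs_minViolated_cons_sub_le hm.q_pos e G) 0
  change m.expect _ _ _ ≤ m.meanViolated N M ^ 2 + M at h4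
  refine div_le_div_of_nonneg_right ?_ (by positivity)
  change _ + (-2 * a * m.meanViolated N M + a ^ 2) ≤ _
  have h5 : (M - m.meanViolated N M - h * N) = a - m.meanViolated N M := by rw [ha]; ring
  rw [h5]
  linarith

/-! ### Binomial estimates -/

lemma sum_binomial_weight (M : ℕ) (θ : ℝ) :
    ∑ k ∈ Finset.range (M + 1), (M.choose k * θ ^ k * (1 - θ) ^ (M - k)) = 1 := by
  have := add_pow θ (1 - θ) M
  rw [add_sub_cancel, one_pow] at this
  refine Eq.trans ?_ this.symm
  exact Finset.sum_congr rfl fun k _ => by ring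

lemma sum_binomial_weight_mul_sq (M : ℕ) (θ : ℝ) :
    ∑ k ∈ Finset.range (M + 1), (M.choose k * θ ^ k * (1 - θ) ^ (M - k)) * (k - M * θ) ^ 2 =
      M * θ * (1 - θ) := by
  have := congrArg (Polynomial.eval θ) (bernsteinPolynomial.variance ℝ M)
  simp only [Polynomial.eval_finsetSum, bernsteinPolynomial, nsmul_eq_mul, Polynomial.eval_mul,
    Polynomial.eval_pow, Polynomial.eval_sub, Polynomial.eval_natCast, Polynomial.eval_X,
    Polynomial.eval_one] at this
  rw [← this]
  exact Finset.sum_congr rfl fun k _ => by ring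

/-- The approximate subadditivity of the expected number of violated hyperedges: the error is of
the order of the standard deviation of the binomial mixture. -/
lemma IsConvex.meanViolated_subadditive (hm : m.IsConvex) {α β D : ℝ}
    (hD : 0 < D) : ∃ C : ℝ, 0 ≤ C ∧ ∀ N₁ N₂ m₁ m₂ : ℕ, 2 ≤ N₁ → 2 ≤ N₂ →
      α * N₁ ≤ m₁ → m₁ ≤ β * N₁ → α * N₂ ≤ m₂ → m₂ ≤ β * N₂ →
      |(m₁ : ℝ) * N₂ - m₂ * N₁| ≤ D * (N₁ + N₂) →
      m.meanViolated (N₁ + N₂) (m₁ + m₂) ≤ m.meanViolated N₁ m₁ + m.meanViolated N₂ m₂ +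
        C * √((N₁ : ℝ) * N₂ / (N₁ + N₂)) := by
  refine ⟨2 * D + 1 + |β|, by positivity, fun N₁ N₂ m₁ m₂ hN₁ hN₂ _ hβ₁ _ hβ₂ ht => ?_⟩
  have h1 : (2 : ℝ) ≤ N₁ := by exact_mod_cast hN₁
  have h2 : (2 : ℝ) ≤ N₂ := by exact_mod_cast hN₂
  set M := m₁ + m₂ with hM
  have hMr : (M : ℝ) = m₁ + m₂ := by rw [hM]; push_cast; ring
  set θ : ℝ := (N₁ : ℝ) / (N₁ + N₂) with hθ
  set s : ℝ := (N₁ : ℝ) * N₂ / (N₁ + N₂) with hs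
  have hs1 : 1 ≤ s := by
    rw [hs, le_div_iff₀ (by positivity)]
    nlinarith
  have hθ0 : 0 ≤ θ := by positivity
  have hθ1 : 1 - θ = (N₂ : ℝ) / (N₁ + N₂) := by rw [hθ]; field_simp; ring
  have hθ10 : 0 ≤ 1 - θ := by rw [hθ1]; positivity
  have hroot : 1 ≤ √s := Real.one_le_sqrt.2 hs1
  have hroot2 : √s * √s = s := Real.mul_self_sqrt (by linarith)
  refine (hm.meanViolated_le (by omega) (by omega) M hθ).trans ?_
  set w : ℕ → ℝ := fun k => M.choose k * θ ^ k * (1 - θ) ^ (M - k) with hw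
  have hw0 : ∀ k, 0 ≤ w k := fun k => by positivity
  have hvar : M * θ * (1 - θ) ≤ |β| * s := by
    have : M * θ * (1 - θ) = M / (N₁ + N₂) * s := by rw [hθ1, hθ, hs]; field_simp
    rw [this]
    gcongr
    rw [div_le_iff₀ (by positivity), hMr]
    have := mul_le_mul_of_nonneg_right (le_abs_self β) (show (0 : ℝ) ≤ N₁ + N₂ by positivity)
    linarith
  have hshift : |M * θ - m₁| ≤ D := by
    have : M * θ - m₁ = -((m₁ : ℝ) * N₂ - m₂ * N₁) / (N₁ + N₂) := by
      rw [hMr, hθ]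
      field_simp
      ring
    rw [this, abs_div, abs_neg, abs_of_pos (show (0 : ℝ) < N₁ + N₂ by positivity),
      div_le_iff₀ (by positivity)]
    exact ht
  -- The deviation is bounded by `|d| ≤ (√s + d ^ 2 / √s) / 2`.
  have hterm : ∀ k ∈ Finset.range (M + 1), w k * (m.meanViolated N₁ k + m.meanViolated N₂ (M - k)) ≤
      w k * (m.meanViolated N₁ m₁ + m.meanViolated N₂ m₂ + 2 * D + √s) +
        (w k * (k - M * θ) ^ 2) * (1 / √s) := by
    intro k hk
    have hkM : k ≤ M := Nat.lt_succ_iff.1 (Finset.mem_range.1 hk)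
    have e1 := (abs_le.1 (hm.abs_meanViolated_sub_le (N := N₁) (by omega) k m₁)).2
    have e2 := (abs_le.1 (hm.abs_meanViolated_sub_le (N := N₂) (by omega) (M - k) m₂)).2
    rw [Nat.cast_sub hkM, show (M : ℝ) - k - m₂ = -((k : ℝ) - m₁) by rw [hMr]; ring, abs_neg] at e2
    have e3 : |(k : ℝ) - m₁| ≤ |(k : ℝ) - M * θ| + D := by
      have := abs_add_le ((k : ℝ) - M * θ) (M * θ - m₁)
      rw [sub_add_sub_cancel] at this
      linarith
    have e4 : 2 * |(k : ℝ) - M * θ| ≤ √s + (k - M * θ) ^ 2 * (1 / √s) := by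
      rw [← sq_abs ((k : ℝ) - M * θ), mul_one_div, ← sub_le_iff_le_add', le_div_iff₀ (by linarith)]
      nlinarith [sq_nonneg (√s - |(k : ℝ) - M * θ|)]
    rw [mul_assoc (w k) (_ ^ 2), ← mul_add]
    refine mul_le_mul_of_nonneg_left ?_ (hw0 k)
    linarith
  refine (Finset.sum_le_sum hterm).trans ?_
  rw [Finset.sum_add_distrib, ← Finset.sum_mul, ← Finset.sum_mul, sum_binomial_weight,
    sum_binomial_weight_mul_sq, one_mul]
  have h5 : M * θ * (1 - θ) * (1 / √s) ≤ |β| * √s := by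
    rw [mul_one_div, div_le_iff₀ (by linarith), mul_assoc |β|, hroot2]
    exact hvar
  have h6 := mul_le_mul_of_nonneg_left hroot hD.le
  linarith

lemma log_factorial_le {n : ℕ} (hn : n ≠ 0) :
    Real.log n.factorial ≤ 1 + Real.log n / 2 + n * Real.log n - n := by
  obtain ⟨k, rfl⟩ := Nat.exists_eq_succ_of_ne_zero hn
  have h := Stirling.log_stirlingSeq'_antitone (Nat.zero_le k)
  simp only [Function.comp_apply, Nat.succ_eq_add_one, zero_add] at h
  rw [Stirling.log_stirlingSeq_formula, Stirling.stirlingSeq_one, Real.log_div (by positivity)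
    (by positivity), Real.log_exp, Real.log_mul (by norm_num) (by positivity),
    Real.log_div (Real.exp_pos 1).ne' (by positivity), Real.log_exp,
    Real.log_sqrt (by positivity)] at h
  simp only [Nat.succ_eq_add_one]
  linarith

lemma le_log_factorial {n : ℕ} (hn : n ≠ 0) :
    Real.log n / 2 + n * Real.log n - n ≤ Real.log n.factorial := by
  have h := Stirling.le_log_factorial_stirling hn
  have h2 : 0 ≤ Real.log (2 * Real.pi) := Real.log_nonneg (by linarith [Real.pi_gt_three])
  linarith

/-- A binomial probability near the mean is at least of the order of the inverse standard
deviation, by Stirling's formula. -/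
lemma neg_log_binomial_weight_le {a b : ℕ} (ha : 0 < a) (hb : 0 < b) {θ : ℝ} (h0 : 0 < θ)
    (h1 : 0 < 1 - θ) : -Real.log ((a + b).choose a * θ ^ a * (1 - θ) ^ b) ≤
      2 + √((a : ℝ) * b / (a + b)) + ((a - (a + b) * θ) ^ 2 / ((a + b) * θ) +
        (a - (a + b) * θ) ^ 2 / ((a + b) * (1 - θ))) := by
  have ha' : (0 : ℝ) < a := by exact_mod_cast ha
  have hb' : (0 : ℝ) < b := by exact_mod_cast hb
  have hchoose : Real.log ((a + b).choose a) = Real.log (a + b).factorial -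
      Real.log a.factorial - Real.log b.factorial := by
    rw [Nat.cast_add_choose ℝ, Real.log_div (by positivity) (by positivity),
      Real.log_mul (by positivity) (by positivity)]
    ring
  have hc : (0 : ℝ) < (a + b).choose a := by exact_mod_cast Nat.choose_pos (Nat.le_add_right a b)
  rw [Real.log_mul (by positivity) (by positivity), Real.log_mul (by positivity) (by positivity),
    Real.log_pow, Real.log_pow, hchoose]
  have f1 := le_log_factorial (n := a + b) (by omega)
  have f2 := log_factorial_le ha.ne'
  have f3 := log_factorial_le hb.ne'
  push_cast at f1
  have g1 : Real.log ((a : ℝ) * b / (a + b)) / 2 ≤ √((a : ℝ) * b / (a + b)) := by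
    have hx : 0 < (a : ℝ) * b / (a + b) := by positivity
    have := Real.log_le_sub_one_of_pos (Real.sqrt_pos.2 hx)
    rw [Real.log_sqrt hx.le] at this
    linarith
  rw [Real.log_div (by positivity) (by positivity), Real.log_mul ha'.ne' hb'.ne'] at g1
  have g2 := Real.log_le_sub_one_of_pos (show 0 < (a : ℝ) / ((a + b) * θ) by positivity)
  have g3 := Real.log_le_sub_one_of_pos (show 0 < (b : ℝ) / ((a + b) * (1 - θ)) by positivity)
  rw [Real.log_div (by positivity) (by positivity), Real.log_mul (by positivity) (by positivity)]
    at g2 g3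
  have g2' := mul_le_mul_of_nonneg_left g2 ha'.le
  have g3' := mul_le_mul_of_nonneg_left g3 hb'.le
  have chi : a * ((a : ℝ) / ((a + b) * θ) - 1) + b * ((b : ℝ) / ((a + b) * (1 - θ)) - 1) =
      (a - (a + b) * θ) ^ 2 / ((a + b) * θ) + (a - (a + b) * θ) ^ 2 / ((a + b) * (1 - θ)) := by
    have := h0.ne'
    have := h1.ne'
    field_simp
    ring
  rw [← chi]
  linarith

lemma IsConvex.neg_log_probSat_subadditive (hm : m.IsConvex) (hq : 2 ≤ m.q) {α β D : ℝ}
    (hα : 0 < α) : ∃ C : ℝ, 0 ≤ C ∧ ∀ N₁ N₂ m₁ m₂ : ℕ, 2 ≤ N₁ → 2 ≤ N₂ →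
      α * N₁ ≤ m₁ → m₁ ≤ β * N₁ → α * N₂ ≤ m₂ → m₂ ≤ β * N₂ →
      |(m₁ : ℝ) * N₂ - m₂ * N₁| ≤ D * (N₁ + N₂) →
      -Real.log (m.probSat (N₁ + N₂) (m₁ + m₂)) ≤ -Real.log (m.probSat N₁ m₁) +
        -Real.log (m.probSat N₂ m₂) + C * √((N₁ : ℝ) * N₂ / (N₁ + N₂)) := by
  refine ⟨2 + √β + 2 * (D ^ 2 / α), by positivity,
    fun N₁ N₂ m₁ m₂ hN₁ hN₂ hα₁ hβ₁ hα₂ hβ₂ ht => ?_⟩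
  have h1 : (2 : ℝ) ≤ N₁ := by exact_mod_cast hN₁
  have h2 : (2 : ℝ) ≤ N₂ := by exact_mod_cast hN₂
  have hm₁ : (0 : ℝ) < m₁ := lt_of_lt_of_le (by positivity) hα₁
  have hm₂ : (0 : ℝ) < m₂ := lt_of_lt_of_le (by positivity) hα₂
  have hβ : 0 ≤ β := by
    by_contra hneg
    nlinarith
  set θ : ℝ := (N₁ : ℝ) / (N₁ + N₂) with hθ
  set s : ℝ := (N₁ : ℝ) * N₂ / (N₁ + N₂) with hs
  have hs1 : 1 ≤ s := by
    rw [hs, le_div_iff₀ (by positivity)]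
    nlinarith
  have hroot : 1 ≤ √s := Real.one_le_sqrt.2 hs1
  have hθ0 : 0 < θ := by positivity
  have hθ1 : 1 - θ = (N₂ : ℝ) / (N₁ + N₂) := by rw [hθ]; field_simp; ring
  have hθ10 : 0 < 1 - θ := by rw [hθ1]; positivity
  set P : ℝ := (m₁ + m₂).choose m₁ * θ ^ m₁ * (1 - θ) ^ m₂ with hP
  have hc : (0 : ℝ) < (m₁ + m₂).choose m₁ := by
    exact_mod_cast Nat.choose_pos (Nat.le_add_right m₁ m₂)
  have hP0 : 0 < P := by positivity
  have p1 := hm.probSat_pos hq hN₁ m₁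
  have p2 := hm.probSat_pos hq hN₂ m₂
  have hle : P * (m.probSat N₁ m₁ * m.probSat N₂ m₂) ≤ m.probSat (N₁ + N₂) (m₁ + m₂) := by
    refine le_trans ?_ (hm.le_probSat (by omega) (by omega) (m₁ + m₂) hθ)
    have := Finset.single_le_sum (f := fun k => ((m₁ + m₂).choose k * θ ^ k *
      (1 - θ) ^ (m₁ + m₂ - k)) * (m.probSat N₁ k * m.probSat N₂ (m₁ + m₂ - k)))
      (s := Finset.range (m₁ + m₂ + 1)) (fun k _ => by
        have q1 := hm.probSat_pos hq hN₁ k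
        have q2 := hm.probSat_pos hq hN₂ (m₁ + m₂ - k)
        positivity) (Finset.mem_range.2 (show m₁ < m₁ + m₂ + 1 by omega))
    simpa only [Nat.add_sub_cancel_left] using this
  have hlog := Real.log_le_log (by positivity) hle
  rw [Real.log_mul hP0.ne' (by positivity), Real.log_mul p1.ne' p2.ne'] at hlog
  have hbin := neg_log_binomial_weight_le (by exact_mod_cast hm₁) (by exact_mod_cast hm₂) hθ0 hθ10
  rw [← hP] at hbin
  have hX : √((m₁ : ℝ) * m₂ / (m₁ + m₂)) ≤ √β * √s := by
    rw [← Real.sqrt_mul hβ]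
    apply Real.sqrt_le_sqrt
    rw [hs, mul_div_assoc', div_le_div_iff₀ (by positivity) (by positivity)]
    have e1 := mul_le_mul_of_nonneg_left hβ₂ (mul_nonneg hm₁.le (show (0 : ℝ) ≤ N₁ by positivity))
    have e2 := mul_le_mul_of_nonneg_left hβ₁ (mul_nonneg hm₂.le (show (0 : ℝ) ≤ N₂ by positivity))
    linarith
  have hM : α * (N₁ + N₂) ≤ m₁ + m₂ := by linarith
  have hsq : ((m₁ : ℝ) - (m₁ + m₂) * θ) ^ 2 ≤ D ^ 2 := by
    have : (m₁ : ℝ) - (m₁ + m₂) * θ = ((m₁ : ℝ) * N₂ - m₂ * N₁) / (N₁ + N₂) := by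
      rw [hθ]
      field_simp
      ring
    rw [this, ← sq_abs, abs_div, abs_of_pos (show (0 : ℝ) < N₁ + N₂ by positivity)]
    have := (div_le_iff₀ (show (0 : ℝ) < N₁ + N₂ by positivity)).2 ht
    gcongr
  have d1 : α ≤ (m₁ + m₂) * θ := by
    rw [hθ, mul_div_assoc', le_div_iff₀ (by positivity)]
    nlinarith
  have d2 : α ≤ (m₁ + m₂) * (1 - θ) := by
    rw [hθ1, mul_div_assoc', le_div_iff₀ (by positivity)]
    nlinarith
  have c1 : ((m₁ : ℝ) - (m₁ + m₂) * θ) ^ 2 / ((m₁ + m₂) * θ) ≤ D ^ 2 / α :=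
    div_le_div₀ (by positivity) hsq hα d1
  have c2 : ((m₁ : ℝ) - (m₁ + m₂) * θ) ^ 2 / ((m₁ + m₂) * (1 - θ)) ≤ D ^ 2 / α :=
    div_le_div₀ (by positivity) hsq hα d2
  have h6 : 2 * (D ^ 2 / α) ≤ 2 * (D ^ 2 / α) * √s :=
    le_mul_of_one_le_right (by positivity) hroot
  linarith

end ConstraintModel

/-! ### Approximately subadditive functions of two sizes -/

/-- The conditions on a function `F N M` of a number of nodes and a number of hyperedges for the
limits of `F N ⌊c N⌋ / N` to exist and to have a threshold. They concern only `N ≥ 2`, since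
with one node the probability of a proper coloring can vanish. The subadditivity error is measured
by the root of `N₁ N₂ / (N₁ + N₂)`, which the gap `√N₁ + √N₂ - √(N₁ + N₂)` dominates. -/
structure ApproxSubadditive (F : ℕ → ℕ → ℝ) : Prop where
  nonneg : ∀ N M, 2 ≤ N → 0 ≤ F N M
  mono : ∀ N, 2 ≤ N → Monotone (F N)
  linear_le : ∃ A B : ℝ, 0 < B ∧ ∀ N M : ℕ, 2 ≤ N → B * M - A * N ≤ F N M
  add_le : ∀ α β D : ℝ, 0 < α → 0 < D → ∃ C : ℝ, 0 ≤ C ∧ ∀ N₁ N₂ m₁ m₂ : ℕ, 2 ≤ N₁ → 2 ≤ N₂ →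
    α * N₁ ≤ m₁ → m₁ ≤ β * N₁ → α * N₂ ≤ m₂ → m₂ ≤ β * N₂ →
    |(m₁ : ℝ) * N₂ - m₂ * N₁| ≤ D * (N₁ + N₂) →
    F (N₁ + N₂) (m₁ + m₂) ≤ F N₁ m₁ + F N₂ m₂ + C * √((N₁ : ℝ) * N₂ / (N₁ + N₂))

lemma sqrt_parallel_le {a b : ℝ} (ha : 0 < a) (hb : 0 < b) :
    √(a * b / (a + b)) ≤ 2 * (√a + √b - √(a + b)) := by
  have hx := Real.sqrt_pos.2 ha
  have hy := Real.sqrt_pos.2 hb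
  have hz := Real.sqrt_pos.2 (add_pos ha hb)
  rw [Real.sqrt_div (by positivity), Real.sqrt_mul ha.le, div_le_iff₀ hz]
  have hxx := Real.mul_self_sqrt ha.le
  have hyy := Real.mul_self_sqrt hb.le
  have hzz := Real.mul_self_sqrt (add_pos ha hb).le
  set x := √a
  set y := √b
  set z := √(a + b)
  -- With `z ^ 2 = x ^ 2 + y ^ 2`, the claim is `x y ≤ 2 z (x + y - z)`.
  have hz2 : z * z = x * x + y * y := by rw [hxx, hyy, hzz]
  have hzxy : z ≤ x + y := by nlinarith [mul_pos hx hy]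
  have hu : (x + y - z) * (x + y + z) = 2 * (x * y) := by linear_combination -hz2
  have hxz : x + y ≤ 2 * z := by nlinarith [sq_nonneg (x - y)]
  nlinarith [mul_nonneg (sub_nonneg.2 hzxy) (show 0 ≤ 3 * z - (x + y + z) by linarith)]

lemma abs_cross_sub_le {m₁ m₂ N₁ N₂ c D : ℝ} (h₁ : 0 ≤ N₁) (h₂ : 0 ≤ N₂)
    (d₁ : |m₁ - c * N₁| ≤ D) (d₂ : |m₂ - c * N₂| ≤ D) :
    |m₁ * N₂ - m₂ * N₁| ≤ D * (N₁ + N₂) := by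
  have e : m₁ * N₂ - m₂ * N₁ = (m₁ - c * N₁) * N₂ - (m₂ - c * N₂) * N₁ := by ring
  rw [e]
  refine (abs_sub _ _).trans ?_
  rw [abs_mul, abs_mul, abs_of_nonneg h₁, abs_of_nonneg h₂]
  nlinarith [mul_le_mul_of_nonneg_right d₁ h₂, mul_le_mul_of_nonneg_right d₂ h₁]

lemma sqrt_parallel_le_two {N r : ℕ} (hN : 2 ≤ N) (hr : 2 ≤ r) (hr3 : r ≤ 3) :
    √((N : ℝ) * r / (N + r)) ≤ 2 := by
  rw [Real.sqrt_le_left (by norm_num), div_le_iff₀ (by positivity)]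
  have h1 : (r : ℝ) ≤ 3 := by exact_mod_cast hr3
  have h2 : (0 : ℝ) ≤ N := by positivity
  nlinarith

namespace ApproxSubadditive

variable {F : ℕ → ℕ → ℝ}

/-- Along even numbers of nodes, adding a multiple of the square root makes the sequence exactly
subadditive, and Fekete's lemma applies. -/
lemma exists_tendsto_even (hF : ApproxSubadditive F) {c : ℝ} (hc : 0 < c) :
    ∃ L : ℝ, Tendsto (fun n : ℕ => F (2 * n) ⌈c * (2 * n : ℕ)⌉₊ / n) atTop (𝓝 L) := by
  obtain ⟨C, hC, hsub⟩ := hF.add_le c (c + 1) 1 hc one_pos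
  let u : ℕ → ℝ := fun n => if n = 0 then 0 else
    F (2 * n) ⌈c * (2 * n : ℕ)⌉₊ + 2 * C * √((2 * n : ℕ) : ℝ)
  have hu : ∀ n, n ≠ 0 → u n = F (2 * n) ⌈c * (2 * n : ℕ)⌉₊ + 2 * C * √((2 * n : ℕ) : ℝ) :=
    fun n hn => if_neg hn
  have hbd : ∀ N : ℕ, 2 ≤ N → c * N ≤ (⌈c * N⌉₊ : ℝ) ∧ (⌈c * N⌉₊ : ℝ) ≤ (c + 1) * N ∧
      |(⌈c * N⌉₊ : ℝ) - c * N| ≤ 1 := by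
    intro N hN
    have h1 := Nat.le_ceil (c * N)
    have h2 := Nat.ceil_lt_add_one (show 0 ≤ c * N by positivity)
    have h3 : (2 : ℝ) ≤ N := by exact_mod_cast hN
    exact ⟨h1, by linarith, abs_le.2 ⟨by linarith, by linarith⟩⟩
  have hsubadd : Subadditive u := by
    intro i j
    rcases Nat.eq_zero_or_pos i with rfl | hi
    · simp [u]
    rcases Nat.eq_zero_or_pos j with rfl | hj
    · simp [u]
    rw [hu _ hi.ne', hu _ hj.ne', hu _ (by omega)]
    obtain ⟨a1, a2, a3⟩ := hbd (2 * i) (by omega)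
    obtain ⟨b1, b2, b3⟩ := hbd (2 * j) (by omega)
    have h1 := hsub (2 * i) (2 * j) _ _ (by omega) (by omega) a1 a2 b1 b2
      (abs_cross_sub_le (by positivity) (by positivity) a3 b3)
    have h2 : F (2 * (i + j)) ⌈c * (2 * (i + j) : ℕ)⌉₊ ≤
        F (2 * i + 2 * j) (⌈c * (2 * i : ℕ)⌉₊ + ⌈c * (2 * j : ℕ)⌉₊) := by
      rw [mul_add]
      refine hF.mono _ (by omega) ?_
      rw [Nat.cast_add, mul_add]
      exact Nat.ceil_add_le _ _
    have h3 := mul_le_mul_of_nonneg_left (sqrt_parallel_le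
      (show (0 : ℝ) < (2 * i : ℕ) by exact_mod_cast (by omega : 0 < 2 * i))
      (show (0 : ℝ) < (2 * j : ℕ) by exact_mod_cast (by omega : 0 < 2 * j))) hC
    have h4 : ((2 * (i + j) : ℕ) : ℝ) = (2 * i : ℕ) + (2 * j : ℕ) := by push_cast; ring
    rw [h4]
    rw [h4] at h2
    linarith
  have hbdd : BddBelow (Set.range fun n => u n / n) := by
    refine ⟨0, ?_⟩
    rintro _ ⟨n, rfl⟩
    rcases Nat.eq_zero_or_pos n with rfl | hn
    · simp
    · have := hF.nonneg (2 * n) ⌈c * (2 * n : ℕ)⌉₊ (by omega)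
      simp only
      rw [hu n hn.ne']
      positivity
  refine ⟨hsubadd.lim, ?_⟩
  have hroot : Tendsto (fun n : ℕ => 2 * C * (√2 / √(n : ℝ))) atTop (𝓝 0) := by
    rw [← mul_zero (2 * C)]
    refine Tendsto.const_mul _ (Tendsto.const_div_atTop ?_ _)
    exact Real.tendsto_sqrt_atTop.comp tendsto_natCast_atTop_atTop
  have h := (hsubadd.tendsto_lim hbdd).sub hroot
  rw [sub_zero] at h
  refine h.congr' ?_
  filter_upwards [eventually_gt_atTop 0] with n hn
  have hn' : (0 : ℝ) < n := by exact_mod_cast hn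
  have : √((2 * n : ℕ) : ℝ) / n = √2 / √(n : ℝ) := by
    push_cast
    rw [Real.sqrt_mul (by norm_num), div_eq_div_iff hn'.ne' (Real.sqrt_pos.2 hn').ne', mul_assoc,
      Real.mul_self_sqrt hn'.le]
  rw [hu n hn.ne', add_div, mul_div_assoc, this]
  ring

/-- The limit exists along all numbers of nodes: an even number of nodes within distance three on
either side is reached by adding or removing a bounded instance. -/
lemma exists_tendsto (hF : ApproxSubadditive F) {c : ℝ} (hc : 0 < c) :
    ∃ ℓ : ℝ, Tendsto (fun N : ℕ => F N ⌊c * (N : ℝ)⌋₊ / N) atTop (𝓝 ℓ) := by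
  obtain ⟨L, hL⟩ := hF.exists_tendsto_even hc
  obtain ⟨C, hC, hsub⟩ := hF.add_le c (c + 1) 1 hc one_pos
  obtain ⟨C', hC', hsub'⟩ := hF.add_le (c / 2) (c + 1) 2 (by positivity) two_pos
  let a : ℕ → ℝ := fun n => F (2 * n) ⌈c * (2 * n : ℕ)⌉₊
  let K : ℝ := F 2 ⌈c * (2 : ℕ)⌉₊ + F 3 ⌈c * (3 : ℕ)⌉₊ + C * 2
  let K' : ℝ := F 2 (1 + ⌈c * (2 : ℕ)⌉₊) + F 3 (1 + ⌈c * (3 : ℕ)⌉₊) + C' * 2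
  have hceil : ∀ N : ℕ, c * N ≤ (⌈c * N⌉₊ : ℝ) ∧ (⌈c * N⌉₊ : ℝ) ≤ c * N + 1 := fun N =>
    ⟨Nat.le_ceil _, (Nat.ceil_lt_add_one (by positivity)).le⟩
  have hupper : ∀ N : ℕ, 4 ≤ N → F N ⌊c * (N : ℝ)⌋₊ ≤ a (N / 2 - 1) + K := by
    intro N hN
    obtain ⟨n, r, hn, hNr, hn1, hr2, hr3⟩ : ∃ n r : ℕ, N / 2 - 1 = n ∧ N = 2 * n + r ∧
      1 ≤ n ∧ 2 ≤ r ∧ r ≤ 3 := ⟨N / 2 - 1, N - 2 * (N / 2 - 1), rfl, by omega, by omega, by omega,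
        by omega⟩
    rw [hn]
    obtain ⟨x1, x2⟩ := hceil (2 * n)
    obtain ⟨y1, y2⟩ := hceil r
    have hn2 : (2 : ℝ) ≤ (2 * n : ℕ) := by exact_mod_cast (by omega : 2 ≤ 2 * n)
    have hr2' : (2 : ℝ) ≤ r := by exact_mod_cast hr2
    have h1 := hsub (2 * n) r ⌈c * (2 * n : ℕ)⌉₊ ⌈c * r⌉₊ (by omega) hr2 x1 (by linarith)
      y1 (by linarith) (abs_cross_sub_le (c := c) (by positivity) (by positivity)
        (abs_le.2 ⟨by linarith, by linarith⟩) (abs_le.2 ⟨by linarith, by linarith⟩))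
    have h2 : F N ⌊c * (N : ℝ)⌋₊ ≤ F (2 * n + r) (⌈c * (2 * n : ℕ)⌉₊ + ⌈c * r⌉₊) := by
      rw [hNr]
      refine hF.mono _ (by omega) ((Nat.floor_le_ceil _).trans ?_)
      rw [Nat.cast_add, mul_add]
      exact Nat.ceil_add_le _ _
    have h3 := mul_le_mul_of_nonneg_left
      (sqrt_parallel_le_two (N := 2 * n) (by omega) hr2 hr3) hC
    have h4 : F r ⌈c * r⌉₊ ≤ F 2 ⌈c * (2 : ℕ)⌉₊ + F 3 ⌈c * (3 : ℕ)⌉₊ := by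
      have p2 := hF.nonneg 2 ⌈c * (2 : ℕ)⌉₊ le_rfl
      have p3 := hF.nonneg 3 ⌈c * (3 : ℕ)⌉₊ (by norm_num)
      obtain rfl | rfl : r = 2 ∨ r = 3 := by omega
      · linarith
      · linarith
    simp only [a, K]
    linarith
  have hlower : ∀ N : ℕ, 2 ≤ N → 2 / c ≤ N → a ((N + 3) / 2) - K' ≤ F N ⌊c * (N : ℝ)⌋₊ := by
    intro N hN hNc
    obtain ⟨n, r, hn, hNr, hr2, hr3⟩ : ∃ n r : ℕ, (N + 3) / 2 = n ∧ 2 * n = N + r ∧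
      2 ≤ r ∧ r ≤ 3 := ⟨(N + 3) / 2, 2 * ((N + 3) / 2) - N, rfl, by omega, by omega, by omega⟩
    rw [hn]
    obtain ⟨y1, y2⟩ := hceil r
    have hr2' : (2 : ℝ) ≤ r := by exact_mod_cast hr2
    have hN2 : (2 : ℝ) ≤ N := by exact_mod_cast hN
    have x1 := Nat.floor_le (show 0 ≤ c * (N : ℝ) by positivity)
    have x2 := Nat.lt_floor_add_one (c * (N : ℝ))
    rw [div_le_iff₀ hc] at hNc
    have hcast : ((1 + ⌈c * r⌉₊ : ℕ) : ℝ) = 1 + ⌈c * r⌉₊ := by push_cast; ring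
    have h1 := hsub' N r ⌊c * (N : ℝ)⌋₊ (1 + ⌈c * r⌉₊) hN hr2 (by linarith) (by linarith)
      (by rw [hcast]; nlinarith) (by rw [hcast]; linarith)
      (abs_cross_sub_le (c := c) (by positivity) (by positivity)
        (abs_le.2 ⟨by linarith, by linarith⟩)
        (abs_le.2 ⟨by rw [hcast]; linarith, by rw [hcast]; linarith⟩))
    have h2 : a n ≤ F (N + r) (⌊c * (N : ℝ)⌋₊ + (1 + ⌈c * r⌉₊)) := by
      simp only [a]
      rw [hNr]
      refine hF.mono _ (by omega) ?_
      rw [Nat.cast_add, mul_add, ← add_assoc]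
      exact (Nat.ceil_add_le _ _).trans (Nat.add_le_add_right (Nat.ceil_le_floor_add_one _) _)
    have h3 := mul_le_mul_of_nonneg_left (sqrt_parallel_le_two hN hr2 hr3) hC'
    have h4 : F r (1 + ⌈c * r⌉₊) ≤ F 2 (1 + ⌈c * (2 : ℕ)⌉₊) + F 3 (1 + ⌈c * (3 : ℕ)⌉₊) := by
      have p2 := hF.nonneg 2 (1 + ⌈c * (2 : ℕ)⌉₊) le_rfl
      have p3 := hF.nonneg 3 (1 + ⌈c * (3 : ℕ)⌉₊) (by norm_num)
      obtain rfl | rfl : r = 2 ∨ r = 3 := by omega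
      · linarith
      · linarith
    simp only [K']
    linarith
  -- Any index sequence within bounded distance of `N / 2` gives the limit `L / 2`.
  have hlim : ∀ (g : ℕ → ℕ) (κ : ℝ), (∀ N, N ≤ 2 * g N + 3) → (∀ N, 2 * g N ≤ N + 3) →
      Tendsto (fun N : ℕ => (a (g N) + κ) / N) atTop (𝓝 (L / 2)) := by
    intro g κ g1 g2
    have hg : Tendsto g atTop atTop :=
      tendsto_atTop_mono (f := fun N => (N - 3) / 2) (fun N => by have := g1 N; omega)
        ((Nat.tendsto_div_const_atTop two_ne_zero).comp (tendsto_sub_atTop_nat 3))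
    have hinv : Tendsto (fun N : ℕ => (N : ℝ)⁻¹) atTop (𝓝 0) :=
      tendsto_inv_atTop_nhds_zero_nat
    have hratio : Tendsto (fun N : ℕ => (g N : ℝ) / N) atTop (𝓝 (1 / 2)) := by
      have l1 : Tendsto (fun N : ℕ => 1 / 2 - 3 / 2 * (N : ℝ)⁻¹) atTop (𝓝 (1 / 2)) := by
        simpa using tendsto_const_nhds.sub (hinv.const_mul (3 / 2))
      have l2 : Tendsto (fun N : ℕ => 1 / 2 + 3 / 2 * (N : ℝ)⁻¹) atTop (𝓝 (1 / 2)) := by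
        simpa using tendsto_const_nhds.add (hinv.const_mul (3 / 2))
      refine tendsto_of_tendsto_of_tendsto_of_le_of_le' l1 l2 ?_ ?_
      · filter_upwards [eventually_gt_atTop 0] with N hN
        have hN' : (0 : ℝ) < N := by exact_mod_cast hN
        have : (N : ℝ) ≤ 2 * g N + 3 := by exact_mod_cast g1 N
        rw [le_div_iff₀ hN', sub_mul, mul_assoc, inv_mul_cancel₀ hN'.ne']
        linarith
      · filter_upwards [eventually_gt_atTop 0] with N hN
        have hN' : (0 : ℝ) < N := by exact_mod_cast hN
        have : (2 * g N : ℝ) ≤ N + 3 := by exact_mod_cast g2 N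
        rw [div_le_iff₀ hN', add_mul, mul_assoc, inv_mul_cancel₀ hN'.ne']
        linarith
    have h := ((hL.comp hg).mul hratio).add (hinv.const_mul κ)
    rw [mul_zero, add_zero, mul_one_div] at h
    refine h.congr' ?_
    filter_upwards [hg.eventually_gt_atTop 0] with N hN
    have hN' : (0 : ℝ) < g N := by exact_mod_cast hN
    simp only [Function.comp_apply, a]
    rw [div_mul_div_cancel₀ hN'.ne', ← div_eq_mul_inv, ← add_div]
  refine ⟨L / 2, tendsto_of_tendsto_of_tendsto_of_le_of_le'
    (hlim (fun N => (N + 3) / 2) (-K') (fun N => by omega) fun N => by omega)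
    (hlim (fun N => N / 2 - 1) K (fun N => by omega) fun N => by omega) ?_ ?_⟩
  · filter_upwards [eventually_ge_atTop 2,
      tendsto_natCast_atTop_atTop.eventually_ge_atTop (2 / c)] with N hN hNc
    exact div_le_div_of_nonneg_right (hlower N hN hNc) (Nat.cast_nonneg N)
  · filter_upwards [eventually_ge_atTop 4] with N hN
    exact div_le_div_of_nonneg_right (hupper N hN) (Nat.cast_nonneg N)

/-- The limit is nonnegative, nondecreasing in `c` and eventually positive, so its zeros form an
interval starting at `0`. -/
lemma exists_limit_threshold (hF : ApproxSubadditive F) : ∃ ℓ : ℝ → ℝ,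
    (∀ c, 0 < c → Tendsto (fun N : ℕ => F N ⌊c * (N : ℝ)⌋₊ / N) atTop (𝓝 (ℓ c))) ∧
    ∃ c₀ : ℝ, 0 ≤ c₀ ∧ (∀ c, 0 < c → c < c₀ → ℓ c = 0) ∧ (∀ c, 0 < c → c₀ < c → 0 < ℓ c) := by
  have hex : ∀ c : ℝ, ∃ ℓ : ℝ, 0 < c →
      Tendsto (fun N : ℕ => F N ⌊c * (N : ℝ)⌋₊ / N) atTop (𝓝 ℓ) := fun c => by
    by_cases hc : 0 < c
    · obtain ⟨ℓ, h⟩ := hF.exists_tendsto hc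
      exact ⟨ℓ, fun _ => h⟩
    · exact ⟨0, fun h => absurd h hc⟩
  choose ℓ hℓ using hex
  have hnonneg : ∀ c, 0 < c → 0 ≤ ℓ c := fun c hc => by
    refine ge_of_tendsto (hℓ c hc) ?_
    filter_upwards [eventually_ge_atTop 2] with N hN
    exact div_nonneg (hF.nonneg _ _ hN) (Nat.cast_nonneg N)
  have hmono : ∀ c c', 0 < c → c ≤ c' → ℓ c ≤ ℓ c' := fun c c' hc hcc' => by
    refine le_of_tendsto_of_tendsto (hℓ c hc) (hℓ c' (hc.trans_le hcc')) ?_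
    filter_upwards [eventually_ge_atTop 2] with N hN
    refine div_le_div_of_nonneg_right (hF.mono N hN (Nat.floor_mono ?_)) (Nat.cast_nonneg N)
    gcongr
  obtain ⟨A, B, hB, hlin⟩ := hF.linear_le
  have hpos : ∀ c, 0 < c → B * c - A ≤ ℓ c := fun c hc => by
    have h1 := (tendsto_nat_floor_mul_div_atTop hc.le).comp tendsto_natCast_atTop_atTop
    refine le_of_tendsto_of_tendsto ((h1.const_mul B).sub_const A) (hℓ c hc) ?_
    filter_upwards [eventually_ge_atTop 2] with N hN
    have hN' : (0 : ℝ) < N := by exact_mod_cast (by omega : 0 < N)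
    simp only [Function.comp_apply]
    rw [le_div_iff₀ hN', sub_mul, mul_assoc, div_mul_cancel₀ _ hN'.ne']
    exact hlin N _ hN
  refine ⟨ℓ, hℓ, ?_⟩
  set S : Set ℝ := insert 0 {c | 0 < c ∧ ℓ c = 0} with hS
  have hbdd : BddAbove S := by
    refine ⟨max 0 (A / B), ?_⟩
    rintro c (rfl | ⟨hc, hc0⟩)
    · exact le_max_left _ _
    · have := hpos c hc
      refine le_max_of_le_right ((le_div_iff₀ hB).2 ?_)
      linarith
  have h0 : (0 : ℝ) ∈ S := Set.mem_insert _ _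
  refine ⟨sSup S, le_csSup hbdd h0, fun c hc hlt => ?_, fun c hc hlt => ?_⟩
  · obtain ⟨c', hc', hcc'⟩ := exists_lt_of_lt_csSup ⟨0, h0⟩ hlt
    rcases hc' with rfl | ⟨_, hc'0⟩
    · exact absurd hcc' hc.not_gt
    · exact le_antisymm (hc'0 ▸ hmono c c' hc hcc'.le) (hnonneg c hc)
  · refine lt_of_le_of_ne (hnonneg c hc) fun h => hlt.not_ge (le_csSup hbdd ?_)
    exact Set.mem_insert_of_mem _ ⟨hc, h.symm⟩

end ApproxSubadditive

/-! ### The three models -/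

lemma sum_prod_indicator_eq {V ι : Type*} [Fintype ι] [DecidableEq ι] {K : ℕ} (k₀ : Fin K)
    (col : V → ι) (e : Fin K → V) :
    ∑ i, ∏ k, (if col (e k) = i then (1 : ℝ) else 0) =
      if ∀ k, col (e k) = col (e k₀) then 1 else 0 := by
  simp only [Finset.prod_boole, Finset.mem_univ, true_imp_iff]
  rw [Finset.sum_eq_single (col (e k₀))]
  · intro i _ hi
    exact if_neg fun h => hi (h k₀).symm
  · simp

namespace ConstraintModel

variable {V : Type}

lemma coloringModel_violates {q : ℕ} (e : (coloringModel q).Clause V) (x : V → Fin q) :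
    (coloringModel q).Violates e x ↔ x (e.1 (0 : Fin 2)) = x (e.1 (1 : Fin 2)) := by
  change (if x (e.1 (0 : Fin 2)) = x (e.1 (1 : Fin 2)) then (0 : ℝ) else 1) = 0 ↔ _
  split_ifs <;> simp_all

lemma kSATModel_violates {K : ℕ} (e : Fin K → V) (a : Fin K → Fin 2) (x : V → Fin 2) :
    (kSATModel K).Violates (e, a) x ↔ x ∘ e = a := by
  change (if x ∘ e = a then (0 : ℝ) else 1) = 0 ↔ _
  split_ifs <;> simp_all

lemma naeKSATModel_violates {K : ℕ} (e : Fin K → V) (a : Fin K → Fin 2) (x : V → Fin 2) :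
    (naeKSATModel K).Violates (e, a) x ↔ x ∘ e = a ∨ x ∘ e = fun i => 1 - a i := by
  change (if x ∘ e = a ∨ x ∘ e = (fun i => 1 - a i) then (0 : ℝ) else 1) = 0 ↔ _
  split_ifs <;> simp_all

lemma forall_fin_two_eq_zero {α : Type*} (f : Fin 2 → α) :
    (∀ k, f k = f 0) ↔ f 0 = f 1 := by
  rw [Fin.forall_fin_two]
  exact ⟨fun h => h.2.symm, fun h => ⟨rfl, h.symm⟩⟩

open Classical in
/-- If every assignment violates each node tuple for at least one label, then it violates at least
the proportion `1 / |Label|` of the hyperedges. -/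
lemma density_of_exists_label (m : ConstraintModel)
    (h : ∀ (V : Type) (x : V → Fin m.q) (e : Fin m.K → V), ∃ a, m.Violates (e, a) x) :
    ∃ δ : ℝ, 0 < δ ∧ ∀ (V : Type) [Fintype V] [Nonempty V] (x : V → Fin m.q),
      δ * Fintype.card (m.Clause V) ≤ ∑ e : m.Clause V, if m.Violates e x then (1 : ℝ) else 0 := by
  have hL : (0 : ℝ) < Fintype.card m.Label := by exact_mod_cast Fintype.card_pos
  refine ⟨1 / Fintype.card m.Label, by positivity, fun V _ _ x => ?_⟩
  rw [Fintype.card_prod, Nat.cast_mul, mul_comm, mul_assoc, mul_one_div_cancel hL.ne',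
    Fintype.sum_prod_type]
  calc (Fintype.card (Fin m.K → V) : ℝ) * 1 = ∑ _e : Fin m.K → V, (1 : ℝ) := by simp
    _ ≤ _ := Finset.sum_le_sum fun e _ => by
      obtain ⟨a, ha⟩ := h V x e
      have := Finset.single_le_sum (f := fun a => if m.Violates (e, a) x then (1 : ℝ) else 0)
        (fun a _ => by positivity) (Finset.mem_univ a)
      simpa [ha] using this

lemma frozenInd_eq_of_iff {m : ConstraintModel} {O : Set (V → Fin m.q)} {e : m.Clause V}
    {P : Prop} {_ : Decidable P} (h : (∀ x ∈ O, m.Violates e x) ↔ P) :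
    m.frozenInd O e = if P then 1 else 0 := by
  classical
  exact if_congr h rfl rfl

/-- For coloring, an edge is violated by all of `O` exactly when its ends have the same color in
every assignment of `O`: the classes of this equivalence relation are the product functions. -/
lemma coloringModel_isConvex {q : ℕ} (hq : 1 ≤ q) : (coloringModel q).IsConvex where
  edgePot_eq a y := by
    simp only [coloringModel]
    split_ifs <;> simp
  q_pos := hq
  frozen V _ O _ := by
    classical
    let col : V → O → Fin q := fun v x => x.1 v
    refine ⟨O → Fin q, inferInstance, 1, fun i v => if col v = i then 1 else 0,
      zero_le_one, fun i v => by positivity, fun e => ?_⟩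
    rw [one_mul]
    refine (Fintype.sum_unique (ι := Unit) _).trans ?_
    refine Eq.trans ?_ (sum_prod_indicator_eq (0 : Fin 2) col e).symm
    refine frozenInd_eq_of_iff ?_
    rw [forall_fin_two_eq_zero fun k => col (e k)]
    exact ⟨fun h => funext fun x => (coloringModel_violates _ _).1 (h x.1 x.2),
      fun h x hx => (coloringModel_violates _ _).2 (congrFun h ⟨x, hx⟩)⟩
  density := by
    classical
    have hq' : (0 : ℝ) < q := by exact_mod_cast hq
    refine ⟨1 / q, by positivity, fun V _ _ => fun (x : V → Fin q) => ?_⟩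
    have hsum : ∀ g : (coloringModel q).Clause V → ℝ, ∑ e, g e = ∑ e : Fin 2 → V, g (e, ()) :=
      fun g => (Fintype.sum_prod_type _).trans
        (Finset.sum_congr rfl fun e _ => Fintype.sum_unique (ι := Unit) _)
    have h1 : (∑ e : (coloringModel q).Clause V,
        if (coloringModel q).Violates e x then (1 : ℝ) else 0) =
        ∑ i : Fin q, (∑ v, if x v = i then (1 : ℝ) else 0) ^ 2 := by
      simp only [Fintype.sum_pow]
      rw [hsum, Finset.sum_comm]
      refine Finset.sum_congr rfl fun e _ => ?_
      rw [sum_prod_indicator_eq (0 : Fin 2) x e]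
      refine if_congr ?_ rfl rfl
      rw [forall_fin_two_eq_zero fun k => x (e k), coloringModel_violates]
    have h2 := sq_sum_le_card_mul_sum_sq (s := Finset.univ)
      (f := fun i : Fin q => ∑ v, if x v = i then (1 : ℝ) else 0)
    have h3 : ∑ i : Fin q, ∑ v, (if x v = i then (1 : ℝ) else 0) = Fintype.card V := by
      rw [Finset.sum_comm]
      simp
    have h4 : (Fintype.card ((coloringModel q).Clause V) : ℝ) = (Fintype.card V : ℝ) ^ 2 := by
      have : Fintype.card ((coloringModel q).Clause V) = Fintype.card ((Fin 2 → V) × Unit) := rfl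
      rw [this]
      simp
    rw [h3, Finset.card_univ, Fintype.card_fin] at h2
    rw [h1, h4, one_div_mul_eq_div, div_le_iff₀ hq']
    linarith
  satisfiable hq2 N hN := by
    classical
    have hq2' : 2 ≤ q := hq2
    let v0 : Fin N := ⟨0, by omega⟩
    let v1 : Fin N := ⟨1, by omega⟩
    let x : Fin N → Fin q := fun v => if v = v0 then ⟨0, by omega⟩ else ⟨1, by omega⟩
    refine ⟨(fun k : Fin 2 => if k = 0 then v0 else v1, ()), x, ?_⟩
    rw [coloringModel_violates]
    simp [x, v0, v1]

open Classical in
/-- For K-SAT, a clause is violated by all of `O` for some label exactly when its nodes are frozen,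
that is, have the same value in every assignment of `O`; the label is then unique. -/
lemma sum_frozenInd_kSATModel [Fintype V] {K : ℕ} {O : Set (V → Fin 2)} {x₀ : V → Fin 2} (hx₀ : x₀ ∈ O)
    (e : Fin K → V) : ∑ a : Fin K → Fin 2, (kSATModel K).frozenInd O (e, a) =
      1 * ∑ _i : Unit, ∏ k, if ∀ x ∈ O, x (e k) = x₀ (e k) then (1 : ℝ) else 0 := by
  rw [one_mul, Fintype.sum_unique (ι := Unit), Finset.prod_boole]
  refine (Finset.sum_eq_single (x₀ ∘ e) (fun a _ ha => ?_) (by simp)).trans ?_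
  · refine if_neg fun h => ha ?_
    exact ((kSATModel_violates e a x₀).1 (h x₀ hx₀)).symm
  · refine frozenInd_eq_of_iff ?_
    exact ⟨fun h k _ x hx => congrFun ((kSATModel_violates e _ x).1 (h x hx)) k,
      fun h x hx => (kSATModel_violates e _ x).2 (funext fun k => h k (Finset.mem_univ _) x hx)⟩

lemma kSATModel_isConvex {K : ℕ} (hK : 2 ≤ K) : (kSATModel K).IsConvex where
  edgePot_eq a y := by
    simp only [kSATModel]
    split_ifs <;> simp
  q_pos := two_pos
  frozen V _ O hO := by
    classical
    obtain ⟨x₀, hx₀⟩ := hO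
    exact ⟨Unit, inferInstance, 1, fun _ v => if ∀ x ∈ O, x v = x₀ v then 1 else 0,
      zero_le_one, fun i v => by positivity, sum_frozenInd_kSATModel hx₀⟩
  density := density_of_exists_label _ fun V x e => ⟨x ∘ e, (kSATModel_violates e _ x).2 rfl⟩
  satisfiable _ N hN := by
    refine ⟨((fun _ => ⟨0, by omega⟩ : Fin K → Fin N), (fun _ => 1 : Fin K → Fin 2)),
      fun _ => (0 : Fin 2), fun h => ?_⟩
    have := congrFun ((kSATModel_violates _ _ _).1 h) ⟨0, by omega⟩
    simp at this

lemma fin_two_add_eq_iff (a b c d : Fin 2) : a + b = c + d ↔ (a = b ↔ c = d) := by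
  revert a b c d
  decide

lemma eq_or_eq_one_sub_iff {K : ℕ} (k₀ : Fin K) (y a : Fin K → Fin 2) :
    (y = a ∨ y = fun i => 1 - a i) ↔ ∀ k, y k + a k = y k₀ + a k₀ := by
  have hflip : ∀ s t : Fin 2, s = 1 - t ↔ ¬ s = t := by decide
  simp only [fin_two_add_eq_iff, funext_iff, hflip]
  constructor
  · rintro (h | h) k
    · simp [h k, h k₀]
    · simp [h k, h k₀]
  · intro h
    by_cases h0 : y k₀ = a k₀
    · exact Or.inl fun k => (h k).2 h0
    · exact Or.inr fun k => fun hk => h0 ((h k).1 hk)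

open Classical in
/-- For NAE-K-SAT, a clause is violated by all of `O` for some label exactly when any two of its
nodes have either always equal or always different values in `O`; there are then two labels.
With a reference assignment `x₀` in `O`, this says that `x + x₀` is constant on the clause for every
`x` in `O`. -/
lemma exists_sum_frozenInd_naeKSATModel [Fintype V] {K : ℕ} (k₀ : Fin K) {O : Set (V → Fin 2)}
    (hO : O.Nonempty) :
    ∃ (ι : Type) (_ : Fintype ι) (κ : ℝ) (f : ι → V → ℝ), 0 ≤ κ ∧ (∀ i v, 0 ≤ f i v) ∧
      ∀ e : Fin K → V, ∑ a : Fin K → Fin 2, (naeKSATModel K).frozenInd O (e, a) =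
        κ * ∑ i, ∏ k, f i (e k) := by
  obtain ⟨x₀, hx₀⟩ := hO
  let col : V → O → Fin 2 := fun v x => x.1 v + x₀ v
  refine ⟨O → Fin 2, inferInstance, 2, fun i v => if col v = i then 1 else 0,
    zero_le_two, fun i v => by positivity, fun e => ?_⟩
  rw [sum_prod_indicator_eq k₀ col e]
  have hlabel : ∀ a : Fin K → Fin 2, (naeKSATModel K).frozenInd O (e, a) =
      if (∀ k, col (e k) = col (e k₀)) ∧ (a = x₀ ∘ e ∨ a = fun k => 1 - (x₀ ∘ e) k)
        then 1 else 0 := by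
    intro a
    refine frozenInd_eq_of_iff ?_
    rw [eq_or_eq_one_sub_iff k₀ a]
    have hv : ∀ x : V → Fin 2, (naeKSATModel K).Violates (e, a) x ↔
        ∀ k, (x ∘ e) k + a k = (x ∘ e) k₀ + a k₀ := fun x =>
      (naeKSATModel_violates e a x).trans (eq_or_eq_one_sub_iff k₀ _ _)
    refine (forall₂_congr fun x _ => hv x).trans ?_
    have halg : ∀ s t u s' t' u' : Fin 2, s + t = s' + t' → u + t = u' + t' →
        s + u = s' + u' := by decide
    have halg' : ∀ s t u s' t' u' : Fin 2, s + u = s' + u' → t + u = t' + u' →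
        s + t = s' + t' := by decide
    have hcomm : ∀ s t s' t' : Fin 2, s + t = s' + t' → t + s = t' + s' := by decide
    constructor
    · intro h
      exact ⟨fun k => funext fun x => halg _ _ _ _ _ _ (h x.1 x.2 k) (h x₀ hx₀ k),
        fun k => hcomm _ _ _ _ (h x₀ hx₀ k)⟩
    · rintro ⟨h1, h2⟩ x hx k
      exact halg' _ _ _ _ _ _ (congrFun (h1 k) ⟨x, hx⟩) (h2 k)
  refine (Finset.sum_congr rfl fun a _ => hlabel a).trans ?_
  by_cases hcol : ∀ k, col (e k) = col (e k₀)
  · simp only [hcol, implies_true, true_and, if_true, mul_one]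
    have hne : x₀ ∘ e ≠ fun k => 1 - (x₀ ∘ e) k := fun h => by
      have hflip : ∀ s : Fin 2, s ≠ 1 - s := by decide
      exact hflip _ (congrFun h k₀)
    rw [Finset.sum_boole]
    have : (Finset.univ.filter fun a : Fin K → Fin 2 =>
        a = x₀ ∘ e ∨ a = fun k => 1 - (x₀ ∘ e) k) = {x₀ ∘ e, fun k => 1 - (x₀ ∘ e) k} := by
      ext a
      simp
    rw [this, Finset.card_pair hne]
    norm_num
  · simp [hcol]

lemma naeKSATModel_isConvex {K : ℕ} (hK : 2 ≤ K) : (naeKSATModel K).IsConvex where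
  edgePot_eq a y := by
    simp only [naeKSATModel]
    split_ifs <;> simp
  q_pos := two_pos
  frozen V _ O hO := exists_sum_frozenInd_naeKSATModel (⟨0, by omega⟩ : Fin K) hO
  density := density_of_exists_label _ fun V x e =>
    ⟨x ∘ e, (naeKSATModel_violates e _ x).2 (Or.inl rfl)⟩
  satisfiable _ N hN := by
    refine ⟨((fun _ => ⟨0, by omega⟩ : Fin K → Fin N),
      (fun k => if (k : ℕ) = 0 then 0 else 1 : Fin K → Fin 2)), fun _ => (0 : Fin 2), fun h => ?_⟩
    rcases (naeKSATModel_violates _ _ _).1 h with h | h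
    · simpa using congrFun h ⟨1, by omega⟩
    · simpa using congrFun h ⟨0, by omega⟩

end ConstraintModel

/-! ### The scaling limits -/

namespace ConstraintModel

variable {m : ConstraintModel}

lemma IsConvex.approxSubadditive_meanViolated (hm : m.IsConvex) :
    ApproxSubadditive m.meanViolated where
  nonneg N M hN := meanViolated_nonneg (by omega) M
  mono N hN := hm.meanViolated_mono (by omega)
  linear_le := by
    obtain ⟨A, B, hB, h⟩ := hm.exists_le_meanViolated
    exact ⟨A, B, hB, fun N M hN => h N M (by omega)⟩
  add_le α β D _ hD := hm.meanViolated_subadditive hD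

lemma IsConvex.approxSubadditive_neg_log_probSat (hm : m.IsConvex) (hq : 2 ≤ m.q) :
    ApproxSubadditive fun N M => -Real.log (m.probSat N M) where
  nonneg N M hN := neg_nonneg.2
    (Real.log_nonpos (hm.probSat_pos hq hN M).le (probSat_le_one (by omega) M))
  mono N hN M M' h := neg_le_neg
    (Real.log_le_log (hm.probSat_pos hq hN M') (hm.probSat_antitone (by omega) h))
  linear_le := hm.exists_le_neg_log_probSat hq
  add_le α β D hα _ := hm.neg_log_probSat_subadditive hq hα

/-- Convergence in probability of the optimal value follows from the convergence of its mean, as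
the variance is at most linear in the number of hyperedges. -/
lemma IsConvex.tendsto_law_real (hm : m.IsConvex) {c ℓ : ℝ} (hc : 0 < c)
    (h : Tendsto (fun N : ℕ => m.meanViolated N ⌊c * (N : ℝ)⌋₊ / N) atTop (𝓝 ℓ)) {ε : ℝ}
    (hε : 0 < ε) :
    Tendsto (fun N : ℕ => (m.law N ⌊c * (N : ℝ)⌋₊).real
      {G | ε < |m.optValue G / (N : ℝ) - (c - ℓ)|}) atTop (𝓝 0) := by
  have hfloor := (tendsto_nat_floor_mul_div_atTop hc.le).comp tendsto_natCast_atTop_atTop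
  have hinv : Tendsto (fun N : ℕ => (N : ℝ)⁻¹) atTop (𝓝 0) := tendsto_inv_atTop_nhds_zero_nat
  have hbound : Tendsto (fun N : ℕ => (((⌊c * (N : ℝ)⌋₊ : ℝ) / N) * (N : ℝ)⁻¹ +
      ((⌊c * (N : ℝ)⌋₊ : ℝ) / N - m.meanViolated N ⌊c * (N : ℝ)⌋₊ / N - (c - ℓ)) ^ 2) / ε ^ 2)
      atTop (𝓝 0) := by
    have := ((hfloor.mul hinv).add (((hfloor.sub h).sub_const (c - ℓ)).pow 2)).div_const (ε ^ 2)
    simpa using this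
  refine squeeze_zero' (Eventually.of_forall fun N => MeasureTheory.measureReal_nonneg) ?_ hbound
  filter_upwards [eventually_gt_atTop 0] with N hN
  have hN' : (0 : ℝ) < N := by exact_mod_cast hN
  refine (hm.law_real_le hN _ (c - ℓ) hε).trans (le_of_eq ?_)
  field_simp

end ConstraintModel

theorem corollary1 (m : ConstraintModel)
    (hm : (∃ q : ℕ, 1 ≤ q ∧ m = coloringModel q) ∨
      (∃ K : ℕ, 2 ≤ K ∧ m = kSATModel K) ∨
      (∃ K : ℕ, 2 ≤ K ∧ m = naeKSATModel K)) :
    (∃ H : ℝ → ℝ,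
      (∀ c : ℝ, 0 < c → ∀ ε : ℝ, 0 < ε →
        Tendsto (fun N : ℕ =>
          (m.law N ⌊c * (N : ℝ)⌋₊).real {G | ε < |m.optValue G / (N : ℝ) - H c|})
          atTop (𝓝 0)) ∧
      ∃ cH : ℝ, 0 ≤ cH ∧
        (∀ c : ℝ, 0 < c → c < cH → H c = c) ∧
        (∀ c : ℝ, 0 < c → cH < c → H c < c)) ∧
    (2 ≤ m.q → ∃ p : ℝ → ℝ,
      (∀ c : ℝ, 0 < c →
        (∀ᶠ N : ℕ in atTop, 0 < m.satProb N ⌊c * (N : ℝ)⌋₊) ∧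
        Tendsto (fun N : ℕ => Real.log (m.satProb N ⌊c * (N : ℝ)⌋₊) / (N : ℝ))
          atTop (𝓝 (p c))) ∧
      ∃ cp : ℝ, 0 ≤ cp ∧
        (∀ c : ℝ, 0 < c → c < cp → p c = 0) ∧
        (∀ c : ℝ, 0 < c → cp < c → p c < 0)) := by
  have hconv : m.IsConvex := by
    rcases hm with ⟨q, hq, rfl⟩ | ⟨K, hK, rfl⟩ | ⟨K, hK, rfl⟩
    · exact ConstraintModel.coloringModel_isConvex hq
    · exact ConstraintModel.kSATModel_isConvex hK
    · exact ConstraintModel.naeKSATModel_isConvex hK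
  refine ⟨?_, fun hq => ?_⟩
  · obtain ⟨ℓ, hlim, c₀, hc₀, hzero, hpos⟩ :=
      hconv.approxSubadditive_meanViolated.exists_limit_threshold
    refine ⟨fun c => c - ℓ c, fun c hc ε hε => hconv.tendsto_law_real hc (hlim c hc) hε, c₀, hc₀,
      fun c hc hlt => ?_, fun c hc hlt => ?_⟩
    · simp [hzero c hc hlt]
    · exact sub_lt_self c (hpos c hc hlt)
  · obtain ⟨ℓ, hlim, c₀, hc₀, hzero, hpos⟩ :=
      (hconv.approxSubadditive_neg_log_probSat hq).exists_limit_threshold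
    refine ⟨fun c => -ℓ c, fun c hc => ⟨?_, ?_⟩, c₀, hc₀, fun c hc hlt => ?_, fun c hc hlt => ?_⟩
    · filter_upwards [eventually_ge_atTop 2] with N hN
      rw [hconv.satProb_eq]
      exact hconv.probSat_pos hq hN _
    · simp only [hconv.satProb_eq]
      simpa only [neg_div, neg_neg] using (hlim c hc).neg
    · simp [hzero c hc hlt]
    · exact neg_neg_of_pos (hpos c hc hlt)
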